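/- Throughout, graphs are finite, simple and undirected, and a graph class is a class of graphs closed under isomorphism. A class $\mathcal C$ is \emph{decomposable} if a graph belongs to $\mathcal C$ if and only if all its connected components do. It is \emph{bridge-addable} if, whenever $G\in\mathcal C$ and $u,v$ are vertices in distinct connected components of $G$, the graph obtained from $G$ by adding the edge $\{u,v\}$ is also in $\mathcal C$. It is \emph{addable} if it is both decomposable and bridge-addable. Let $\mathcal C_n$ be the set of graphs in $\mathcal C$ with vertex set $[n]=\{1,\dots,n\}$, and let $g_n=|\mathcal C_n|$. The class $\mathcal C$ is \emph{smooth} if $g_n>0$ for all sufficiently large $n$ and $\frac{g_n}{n\,g_{n-1}}$ tends to a finite limit as $n\to\infty$. When $\mathcal C_n\neq\emptyset$, let $R_n(\mathcal C)$ be a uniformly random element of $\mathcal C_n$. MSO is monadic second-order logic of graphs: it has quantifiers over vertices and over sets of vertices, and the atomic formulas are $E(x,y)$, $x=y$ and $x\in X$. \textbf{Theorem.} Let $\mathcal C$ be a smooth addable class of graphs. Then for every MSO sentence $\phi$, the probability $\Pr[R_n(\mathcal C)\models\phi]$ converges to a limit as $n\to\infty$. The limit need not be $0$ or $1$: for every such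 $\mathcal C$ there is an MSO sentence $\phi$ for which $\lim_{n\to\infty}\Pr[R_n(\mathcal C)\models\phi]$ exists and lies strictly between $0$ and $1$. -/

import Mathlib

open Filter Topology

/-- Formulas of monadic second-order logic over graphs, in well-scoped (de Bruijn) form:
`MSOFormula k l` is the type of formulas whose free first-order variables are among
`x₀, …, x₍ₖ₋₁₎` and whose free set variables are among `X₀, …, X₍ₗ₋₁₎`.
A quantifier binds the last variable of its kind. -/
inductive MSOFormula : ℕ → ℕ → Type
  /-- the atom `x ∈ X` -/
  | mem {k l : ℕ} (x : Fin k) (X : Fin l) : MSOFormula k l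
  /-- the atom `E(x, y)` -/
  | adj {k l : ℕ} (x y : Fin k) : MSOFormula k l
  /-- the atom `x = y` -/
  | eq {k l : ℕ} (x y : Fin k) : MSOFormula k l
  | and {k l : ℕ} (φ ψ : MSOFormula k l) : MSOFormula k l
  | or {k l : ℕ} (φ ψ : MSOFormula k l) : MSOFormula k l
  | not {k l : ℕ} (φ : MSOFormula k l) : MSOFormula k l
  /-- `∀ x, φ` for a vertex variable `x` -/
  | all {k l : ℕ} (φ : MSOFormula (k + 1) l) : MSOFormula k l
  /-- `∃ x, φ` for a vertex variable `x` -/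
  | ex {k l : ℕ} (φ : MSOFormula (k + 1) l) : MSOFormula k l
  /-- `∀ X, φ` for a set variable `X` -/
  | allSet {k l : ℕ} (φ : MSOFormula k (l + 1)) : MSOFormula k l
  /-- `∃ X, φ` for a set variable `X` -/
  | exSet {k l : ℕ} (φ : MSOFormula k (l + 1)) : MSOFormula k l

/-- MSO sentences: formulas without free variables. -/
abbrev MSOSentence : Type := MSOFormula 0 0

/-- Satisfaction of an MSO formula in the graph `G`, under the valuation that maps the `i`-th
vertex variable to `v i` and the `j`-th set variable to `S j`. -/
def MSOFormula.Realize {V : Type} (G : SimpleGraph V) :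
    {k l : ℕ} → MSOFormula k l → (Fin k → V) → (Fin l → Set V) → Prop
  | _, _, .mem x X, v, S => v x ∈ S X
  | _, _, .adj x y, v, _ => G.Adj (v x) (v y)
  | _, _, .eq x y, v, _ => v x = v y
  | _, _, .and φ ψ, v, S => φ.Realize G v S ∧ ψ.Realize G v S
  | _, _, .or φ ψ, v, S => φ.Realize G v S ∨ ψ.Realize G v S
  | _, _, .not φ, v, S => ¬ φ.Realize G v S
  | _, _, .all φ, v, S => ∀ a : V, φ.Realize G (Fin.snoc v a) S
  | _, _, .ex φ, v, S => ∃ a : V, φ.Realize G (Fin.snoc v a) S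
  | _, _, .allSet φ, v, S => ∀ A : Set V, φ.Realize G v (Fin.snoc S A)
  | _, _, .exSet φ, v, S => ∃ A : Set V, φ.Realize G v (Fin.snoc S A)

/-- `G ⊨ φ` for an MSO sentence `φ`. -/
def SatisfiesMSO {V : Type} (G : SimpleGraph V) (φ : MSOSentence) : Prop :=
  φ.Realize G Fin.elim0 Fin.elim0

/-- A class of finite (simple, undirected) graphs, closed under isomorphism. -/
structure GraphClass where
  /-- the graph `G` belongs to the class -/
  Mem : {V : Type} → [Finite V] → SimpleGraph V → Prop
  iso_closed : ∀ {V W : Type} [Finite V] [Finite W] (G : SimpleGraph V) (H : SimpleGraph W),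
    Nonempty (G ≃g H) → Mem G → Mem H

namespace GraphClass

/-- A graph belongs to the class if and only if all its connected components do. -/
def Decomposable (C : GraphClass) : Prop :=
  ∀ (V : Type) [Finite V] (G : SimpleGraph V),
    C.Mem G ↔ ∀ c : G.ConnectedComponent, C.Mem c.toSimpleGraph

/-- Adding an edge between two distinct connected components does not leave the class. -/
def BridgeAddable (C : GraphClass) : Prop :=
  ∀ (V : Type) [Finite V] (G : SimpleGraph V), C.Mem G →
    ∀ u v : V, G.connectedComponentMk u ≠ G.connectedComponentMk v →
      C.Mem (G ⊔ SimpleGraph.edge u v)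

/-- Addable classes. -/
def Addable (C : GraphClass) : Prop :=
  C.Decomposable ∧ C.BridgeAddable

/-- The graphs of the class on the vertex set `Fin n` (labelled graphs on `n` vertices). -/
def onFin (C : GraphClass) (n : ℕ) : Set (SimpleGraph (Fin n)) :=
  {G | C.Mem G}

/-- The number of graphs of the class on the vertex set `Fin n`. -/
noncomputable def count (C : GraphClass) (n : ℕ) : ℕ :=
  (C.onFin n).ncard

/-- Smoothness: `gₙ / (n gₙ₋₁)` tends to a finite limit, where `gₙ` is the number of graphs of
the class on `n` labelled vertices. The quotient has to make sense for all large `n`, so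
`gₙ ≠ 0` eventually. (The quotient is written with `n + 1` in place of `n`.) -/
def Smooth (C : GraphClass) : Prop :=
  (∀ᶠ n in atTop, C.count n ≠ 0) ∧
    ∃ γ : ℝ, Tendsto
      (fun n : ℕ => (C.count (n + 1) : ℝ) / (((n + 1 : ℕ) : ℝ) * (C.count n : ℝ))) atTop (𝓝 γ)

/-- The probability that a uniformly random graph of the class on `n` labelled vertices
satisfies `φ`. -/
noncomputable def prob (C : GraphClass) (n : ℕ) (φ : MSOSentence) : ℝ :=
  ({G ∈ C.onFin n | SatisfiesMSO G φ}.ncard : ℝ) / (C.count n : ℝ)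

end GraphClass

/-!
The proof follows the structure of a random member `G` of the class: a giant component and a bounded
rest.

*Types.* Monadic second-order types of rank `q` (`MSOType`) are defined by recursion on `q`, with
vertices represented by singletons. They form finite commutative monoids in which the type of a
disjoint union is the sum of the types (`MSOType.of_sum`), and these monoids are aperiodic
(`MSOType.aperiodic`): from some multiplicity on, a further copy of a summand does not matter. This
yields a connected member `P` of the class such that all connected members with a pendant copy of
`P` have one and the same type (`RootedGraph.exists_absorbing`).

*Pendant copies.* Attaching `P` at any of the `n` vertices of a connected member without a pendant
copy of `P` is an injective operation, because the new copy is the only one that can be removed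
again. As smoothness makes the number of members on `n + h` vertices comparable to
`(n + h).choose n` times the number on `n` vertices, only a fraction `O(1 / n)` of the connected
members has no pendant copy of `P` (`GraphClass.Addable.count_withoutPendant_le`). Hence almost all
connected members have the same type.

*Components.* Let `b` and `c` be the coefficients of the exponential generating functions `B` of the
class and `C` of its connected members. Choosing a vertex and splitting off its component gives
`x B' = x C' B`. Adding an edge between two components creates a bridge, and a graph has few
bridges, so the component of a random vertex misses at least `K` vertices with probability at most
`2 / K` (`GraphClass.Addable.tail_le`). For the same reason `c n` differs by at most `2 / K * b n`
from the coefficient of `B exp (-A)`, where `A` is the part of `C` of degree at most `K`; since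
`exp (-A)` is entire, smoothness and dominated convergence give the convergence of the latter
coefficient divided by `b n`. So `c n / b n` converges (`SmoothPair.connected_tendsto`), and the
limit lies strictly between `0` and `1` (`SmoothPair.limit_mem_Ioo`): connectedness is a sentence
with a nontrivial limit.

*Convergence.* The number of members with a given type is a sum over the size of the rest and over
pairs of types of the component of a vertex and of the rest. Each single summand converges after
division by `b n`, and the tail is bounded by `2 / K` (`SmoothPair.exists_tendsto`).
-/

open scoped Pointwise
open Finset.HasAntidiagonal (antidiagonal mem_antidiagonal)

/-! ### Aperiodic finite commutative monoids -/

/-- A commutative monoid in which the multiples of all elements become constant from a common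
point on. -/
def AddAperiodic (M : Type*) [AddCommMonoid M] : Prop :=
  ∃ N : ℕ, ∀ n, N ≤ n → ∀ x : M, (n + 1) • x = n • x

theorem Set.mem_nsmul_iff_multiset {M : Type*} [AddCommMonoid M] (S : Set M) (n : ℕ) (y : M) :
    y ∈ NSMul.nsmul n S ↔ ∃ m : Multiset M, m.card = n ∧ (∀ x ∈ m, x ∈ S) ∧ m.sum = y := by
  induction n generalizing y with
  | zero =>
    rw [show NSMul.nsmul 0 S = 0 from AddMonoid.nsmul_zero S]
    constructor
    · intro h
      exact ⟨0, rfl, by simp, by simpa using h.symm⟩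
    · rintro ⟨m, hm, -, hs⟩
      rw [Multiset.card_eq_zero] at hm
      subst hm
      simpa using hs.symm
  | succ n ih =>
    rw [show NSMul.nsmul (n + 1) S = NSMul.nsmul n S + S from AddMonoid.nsmul_succ n S,
      Set.mem_add]
    constructor
    · rintro ⟨a, ha, b, hb, rfl⟩
      obtain ⟨m, hm, hS, hs⟩ := (ih a).1 ha
      refine ⟨b ::ₘ m, by simp [hm], ?_, by simp [hs, add_comm]⟩
      intro x hx
      rcases Multiset.mem_cons.1 hx with rfl | h
      exacts [hb, hS x h]
    · rintro ⟨m, hm, hS, rfl⟩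
      obtain ⟨b, hb⟩ := Multiset.card_pos_iff_exists_mem.1 (by omega : 0 < m.card)
      obtain ⟨m', rfl⟩ := Multiset.exists_cons_of_mem hb
      exact ⟨m'.sum, (ih _).2 ⟨m', by simpa using hm, fun x hx => hS x (by simp [hx]), rfl⟩,
        b, hS b (by simp), by simp [add_comm]⟩

theorem Multiset.exists_lt_count_of_card {M : Type*} [Fintype M] [DecidableEq M] (m : Multiset M)
    (N : ℕ) (h : N * Fintype.card M < m.card) : ∃ a, N < m.count a := by
  by_contra! hc
  have h1 : m.card = ∑ a : M, m.count a :=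
    (Multiset.sum_count_eq_card (fun a _ => Finset.mem_univ a)).symm
  have h2 : ∑ a : M, m.count a ≤ ∑ _a : M, N := Finset.sum_le_sum fun a _ => hc a
  simp only [Finset.sum_const, Finset.card_univ, smul_eq_mul] at h2
  rw [mul_comm] at h2
  omega

/-- Among sufficiently many summands one value `a` is repeated so often that a further copy of `a`
can be added or removed without changing the sum. -/
theorem AddAperiodic.set {M : Type*} [AddCommMonoid M] [Finite M] (h : AddAperiodic M) :
    AddAperiodic (Set M) := by
  classical
  have := Fintype.ofFinite M
  obtain ⟨N, hN⟩ := h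
  refine ⟨N * Fintype.card M + 1, fun n hn S => ?_⟩
  ext y
  change y ∈ NSMul.nsmul (n + 1) S ↔ y ∈ NSMul.nsmul n S
  rw [Set.mem_nsmul_iff_multiset, Set.mem_nsmul_iff_multiset]
  constructor
  · rintro ⟨m, hm, hS, rfl⟩
    obtain ⟨a, ha⟩ := m.exists_lt_count_of_card N (by omega)
    obtain ⟨m', rfl⟩ := Multiset.le_iff_exists_add.1
      (Multiset.le_count_iff_replicate_le.1 (Nat.succ_le_of_lt ha))
    refine ⟨Multiset.replicate N a + m', by simp at hm ⊢; omega, fun x hx => hS x ?_, ?_⟩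
    · simp only [Multiset.mem_add, Multiset.mem_replicate] at hx ⊢
      tauto
    · rw [Multiset.sum_add, Multiset.sum_add, Multiset.sum_replicate, Multiset.sum_replicate,
        hN N le_rfl a]
  · rintro ⟨m, hm, hS, rfl⟩
    obtain ⟨a, ha⟩ := m.exists_lt_count_of_card N (by omega)
    obtain ⟨m', rfl⟩ := Multiset.le_iff_exists_add.1
      (Multiset.le_count_iff_replicate_le.1 (Nat.succ_le_of_lt ha))
    refine ⟨Multiset.replicate (N + 2) a + m', by simp at hm ⊢; omega, fun x hx => hS x ?_, ?_⟩
    · simp only [Multiset.mem_add, Multiset.mem_replicate] at hx ⊢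
      tauto
    · rw [Multiset.sum_add, Multiset.sum_add, Multiset.sum_replicate, Multiset.sum_replicate,
        hN (N + 1) (Nat.le_succ _) a]

theorem AddAperiodic.prod {M M' : Type*} [AddCommMonoid M] [AddCommMonoid M']
    (h : AddAperiodic M) (h' : AddAperiodic M') : AddAperiodic (M × M') := by
  obtain ⟨N, hN⟩ := h
  obtain ⟨N', hN'⟩ := h'
  refine ⟨max N N', fun n hn x => Prod.ext ?_ ?_⟩
  · simpa using hN n (le_trans (le_max_left _ _) hn) x.1
  · simpa using hN' n (le_trans (le_max_right _ _) hn) x.2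

/-! ### Monadic second-order types -/

/-- The quantifier-free information about a family of vertex sets indexed by `ι`: which of them are
singletons, which of them intersect, and which of them are joined by an edge. Vertices are
represented by singletons, so this covers all atomic formulas. -/
@[ext]
structure MSOAtom (ι : Type) where
  sing : ι → Prop
  inter : ι → ι → Prop
  adj : ι → ι → Prop

namespace MSOAtom

variable {ι : Type}

instance : Zero (MSOAtom ι) := ⟨⟨fun _ => False, fun _ _ => False, fun _ _ => False⟩⟩

/-- The sum of two atoms is the atom of the disjoint union of the structures. Note that `inter i i`
says that the `i`-th set is nonempty. -/
instance : Add (MSOAtom ι) :=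
  ⟨fun x y => ⟨fun i => (x.sing i ∧ ¬ y.inter i i) ∨ (¬ x.inter i i ∧ y.sing i),
    fun i j => x.inter i j ∨ y.inter i j, fun i j => x.adj i j ∨ y.adj i j⟩⟩

theorem add_sing (x y : MSOAtom ι) (i : ι) :
    (x + y).sing i = ((x.sing i ∧ ¬ y.inter i i) ∨ (¬ x.inter i i ∧ y.sing i)) := rfl
theorem add_inter (x y : MSOAtom ι) (i j : ι) :
    (x + y).inter i j = (x.inter i j ∨ y.inter i j) := rfl
theorem add_adj (x y : MSOAtom ι) (i j : ι) : (x + y).adj i j = (x.adj i j ∨ y.adj i j) := rfl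
theorem zero_sing (i : ι) : (0 : MSOAtom ι).sing i = False := rfl
theorem zero_inter (i j : ι) : (0 : MSOAtom ι).inter i j = False := rfl
theorem zero_adj (i j : ι) : (0 : MSOAtom ι).adj i j = False := rfl

instance : AddCommMonoid (MSOAtom ι) where
  add_assoc x y z := by
    ext <;> simp only [add_sing, add_inter, add_adj] <;> tauto
  zero_add x := by
    ext <;> simp only [add_sing, add_inter, add_adj, zero_sing, zero_inter, zero_adj] <;> tauto
  add_zero x := by
    ext <;> simp only [add_sing, add_inter, add_adj, zero_sing, zero_inter, zero_adj] <;> tauto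
  add_comm x y := by
    ext <;> simp only [add_sing, add_inter, add_adj] <;> tauto
  nsmul := nsmulRec

theorem aperiodic : AddAperiodic (MSOAtom ι) := by
  have h : ∀ x : MSOAtom ι, x + x + x = x + x := fun x => by
    ext <;> simp only [add_sing, add_inter, add_adj] <;> tauto
  refine ⟨2, fun n hn x => ?_⟩
  obtain ⟨k, rfl⟩ := Nat.exists_eq_add_of_le' hn
  have h3 : (3 : ℕ) • x = (2 : ℕ) • x := by
    rw [succ_nsmul, two_nsmul, h]
  rw [add_assoc, add_nsmul x k (2 + 1), add_nsmul x k 2]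
  exact congrArg _ h3

instance [Finite ι] : Finite (MSOAtom ι) :=
  Finite.of_injective (fun x : MSOAtom ι => (x.sing, x.inter, x.adj)) fun x y h => by
    simp only [Prod.mk.injEq] at h
    exact MSOAtom.ext h.1 h.2.1 h.2.2

/-- The atom of a graph with a family of vertex sets. -/
def of {V : Type} (G : SimpleGraph V) (S : ι → Set V) : MSOAtom ι where
  sing i := ∃ x, S i = {x}
  inter i j := (S i ∩ S j).Nonempty
  adj i j := ∃ x ∈ S i, ∃ y ∈ S j, G.Adj x y

end MSOAtom

/-- Monadic second-order types of quantifier rank `q` of graphs with a family of vertex sets indexed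
by `ι`: a type of rank `q + 1` lists the types of rank `q` that arise by adding one more set. -/
def MSOType : ℕ → Type → Type
  | 0, ι => MSOAtom ι
  | q + 1, ι => MSOAtom ι × Set (MSOType q (Option ι))

namespace MSOType

instance instAddCommMonoid : ∀ (q : ℕ) (ι : Type), AddCommMonoid (MSOType q ι)
  | 0, ι => inferInstanceAs (AddCommMonoid (MSOAtom ι))
  | q + 1, ι =>
    letI := instAddCommMonoid q (Option ι)
    inferInstanceAs (AddCommMonoid (MSOAtom ι × Set (MSOType q (Option ι))))

instance instFinite : ∀ (q : ℕ) (ι : Type) [Finite ι], Finite (MSOType q ι)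
  | 0, ι, _ => inferInstanceAs (Finite (MSOAtom ι))
  | q + 1, ι, _ =>
    haveI := instFinite q (Option ι)
    inferInstanceAs (Finite (MSOAtom ι × Set (MSOType q (Option ι))))

/-- The reason why monadic second-order logic counts only up to a threshold, and in particular
not modulo a number. -/
theorem aperiodic : ∀ (q : ℕ) (ι : Type) [Finite ι], AddAperiodic (MSOType q ι)
  | 0, ι, _ => MSOAtom.aperiodic (ι := ι)
  | q + 1, ι, _ => (MSOAtom.aperiodic (ι := ι)).prod (aperiodic q (Option ι)).set

/-- A family of vertex sets extended by one more set. -/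
def ext {ι V : Type} (S : ι → Set V) (A : Set V) : Option ι → Set V := fun o => o.elim A S

/-- The type of rank `q` of a graph with a family of vertex sets. -/
def of : (q : ℕ) → {ι V : Type} → SimpleGraph V → (ι → Set V) → MSOType q ι
  | 0, _, _, G, S => MSOAtom.of G S
  | q + 1, _, _, G, S => (MSOAtom.of G S, Set.range fun A => of q G (ext S A))

variable {ι κ V W V' W' : Type}

theorem of_succ_eq_iff {q : ℕ} {G : SimpleGraph V} {S : ι → Set V} {H : SimpleGraph W}
    {R : ι → Set W} : of (q + 1) G S = of (q + 1) H R ↔ MSOAtom.of G S = MSOAtom.of H R ∧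
      (∀ A, ∃ B, of q G (ext S A) = of q H (ext R B)) ∧
      (∀ B, ∃ A, of q G (ext S A) = of q H (ext R B)) := by
  change ((_, _) : _ × _) = (_, _) ↔ _
  rw [Prod.mk.injEq, Set.Subset.antisymm_iff, Set.range_subset_iff, Set.range_subset_iff]
  simp only [Set.mem_range]
  exact and_congr Iff.rfl (and_congr ⟨fun h A => (h A).imp fun B hB => hB.symm,
    fun h A => (h A).imp fun B hB => hB.symm⟩ Iff.rfl)

theorem atom_eq {q : ℕ} {G : SimpleGraph V} {S : ι → Set V} {H : SimpleGraph W} {R : ι → Set W}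
    (h : of q G S = of q H R) : MSOAtom.of G S = MSOAtom.of H R := by
  cases q with
  | zero => exact h
  | succ q => exact (of_succ_eq_iff.1 h).1

/-- The union of a set of vertices on the left and one on the right of a disjoint sum. -/
def sumSets (S : ι → Set V) (R : ι → Set W) : ι → Set (V ⊕ W) :=
  fun i => {x | Sum.elim (· ∈ S i) (· ∈ R i) x}

@[simp] theorem inl_mem_sumSets {S : ι → Set V} {R : ι → Set W} {i : ι} {x : V} :
    Sum.inl x ∈ sumSets S R i ↔ x ∈ S i := Iff.rfl
@[simp] theorem inr_mem_sumSets {S : ι → Set V} {R : ι → Set W} {i : ι} {x : W} :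
    Sum.inr x ∈ sumSets S R i ↔ x ∈ R i := Iff.rfl

theorem ext_sumSets (S : ι → Set V) (R : ι → Set W) (A : Set V) (B : Set W) :
    sumSets (ext S A) (ext R B) = ext (sumSets S R) {x | Sum.elim (· ∈ A) (· ∈ B) x} := by
  funext o
  cases o <;> rfl

theorem _root_.MSOAtom.of_sum (G : SimpleGraph V) (S : ι → Set V) (H : SimpleGraph W)
    (R : ι → Set W) :
    MSOAtom.of (G ⊕g H) (sumSets S R) = MSOAtom.of G S + MSOAtom.of H R := by
  ext i j
  · simp only [MSOAtom.of, MSOAtom.add_sing, Set.ext_iff, Sum.forall, Sum.exists, inl_mem_sumSets,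
      inr_mem_sumSets, Set.mem_singleton_iff, Set.inter_self, Set.Nonempty, Sum.inl.injEq,
      Sum.inr.injEq, reduceCtorEq, iff_false, not_exists]
    constructor
    · rintro (⟨x, h, h'⟩ | ⟨x, h, h'⟩)
      · exact Or.inl ⟨⟨x, h⟩, h'⟩
      · exact Or.inr ⟨h, ⟨x, h'⟩⟩
    · rintro (⟨⟨x, h⟩, h'⟩ | ⟨h, ⟨x, h'⟩⟩)
      · exact Or.inl ⟨x, h, h'⟩
      · exact Or.inr ⟨x, h, h'⟩
  · simp [MSOAtom.of, MSOAtom.add_inter, Set.Nonempty]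
  · simp [MSOAtom.of, MSOAtom.add_adj]

/-- The type of a disjoint union is the sum of the types. -/
theorem of_sum (q : ℕ) (G : SimpleGraph V) (S : ι → Set V) (H : SimpleGraph W) (R : ι → Set W) :
    of q (G ⊕g H) (sumSets S R) = of q G S + of q H R := by
  induction q generalizing ι with
  | zero => exact MSOAtom.of_sum G S H R
  | succ q ih =>
    refine Prod.ext (MSOAtom.of_sum G S H R) ?_
    change Set.range _ = Set.range _ + Set.range _
    ext t
    simp only [Set.mem_range, Set.mem_add]
    constructor
    · rintro ⟨A, rfl⟩
      refine ⟨_, ⟨{x | Sum.inl x ∈ A}, rfl⟩, _, ⟨{x | Sum.inr x ∈ A}, rfl⟩, ?_⟩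
      rw [← ih, ext_sumSets]
      congr 2
      ext x
      cases x <;> rfl
    · rintro ⟨_, ⟨A, rfl⟩, _, ⟨B, rfl⟩, rfl⟩
      exact ⟨{x | Sum.elim (· ∈ A) (· ∈ B) x}, by rw [← ih, ext_sumSets]⟩

theorem of_iso (q : ℕ) {G : SimpleGraph V} {H : SimpleGraph W} (e : G ≃g H) (S : ι → Set W) :
    of q H S = of q G (fun i => e ⁻¹' S i) := by
  induction q generalizing ι with
  | zero =>
    refine MSOAtom.ext (funext fun i => propext ⟨?_, ?_⟩)
      (funext fun i => funext fun j => propext ⟨?_, ?_⟩)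
      (funext fun i => funext fun j => propext ⟨?_, ?_⟩)
    · rintro ⟨x, hx⟩
      refine ⟨e.symm x, ?_⟩
      ext y
      simp only [hx, Set.mem_preimage, Set.mem_singleton_iff]
      exact e.toEquiv.eq_symm_apply.symm
    · rintro ⟨x, hx⟩
      refine ⟨e x, ?_⟩
      ext y
      rw [Set.ext_iff] at hx
      have := hx (e.symm y)
      simp only [Set.mem_preimage, RelIso.apply_symm_apply, Set.mem_singleton_iff] at this ⊢
      rw [this]
      exact e.toEquiv.symm_apply_eq
    · rintro ⟨x, hx, hy⟩
      exact ⟨e.symm x, by simpa using hx, by simpa using hy⟩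
    · rintro ⟨x, hx, hy⟩
      exact ⟨e x, hx, hy⟩
    · rintro ⟨x, hx, y, hy, h⟩
      exact ⟨e.symm x, by simpa using hx, e.symm y, by simpa using hy, e.symm.map_rel_iff.2 h⟩
    · rintro ⟨x, hx, y, hy, h⟩
      exact ⟨e x, hx, e y, hy, e.map_rel_iff.2 h⟩
  | succ q ih =>
    rw [of_succ_eq_iff]
    have key : ∀ A : Set W, of q H (ext S A) = of q G (ext (fun i => e ⁻¹' S i) (e ⁻¹' A)) := by
      intro A
      rw [ih]
      congr 1
      funext o
      cases o <;> rfl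
    refine ⟨atom_eq (q := q) ?_, fun A => ⟨_, key A⟩, fun B => ⟨e.symm ⁻¹' B, ?_⟩⟩
    · exact ih S
    · rw [key]
      congr 2
      ext x
      simp

/-- Selecting, repeating and permuting the sets of a family; `none` selects the empty set. -/
def pull (g : κ → Option ι) (S : ι → Set V) : κ → Set V := fun k => (g k).elim ∅ S

theorem _root_.MSOAtom.of_pull (g : κ → Option ι) {G : SimpleGraph V} {S : ι → Set V}
    {H : SimpleGraph W} {R : ι → Set W} (h' : MSOAtom.of G S = MSOAtom.of H R) :
    MSOAtom.of G (pull g S) = MSOAtom.of H (pull g R) := by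
  have h1 := fun i => congrFun (congrArg MSOAtom.sing h') i
  have h2 := fun i j => congrFun (congrFun (congrArg MSOAtom.inter h') i) j
  have h3 := fun i j => congrFun (congrFun (congrArg MSOAtom.adj h') i) j
  have hne : ∀ {U : Type} (x : U), (∅ : Set U) ≠ {x} := fun x hx =>
    Set.singleton_ne_empty x hx.symm
  refine MSOAtom.ext (funext fun i => ?_) (funext fun i => funext fun j => ?_)
    (funext fun i => funext fun j => ?_)
  · rcases hg : g i with _ | a
    · simp [MSOAtom.of, pull, hg, hne]
    · simpa [MSOAtom.of, pull, hg] using h1 a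
  · rcases hg : g i with _ | a
    · simp [MSOAtom.of, pull, hg]
    · rcases hg' : g j with _ | b
      · simp [MSOAtom.of, pull, hg']
      · simpa [MSOAtom.of, pull, hg, hg'] using h2 a b
  · rcases hg : g i with _ | a
    · simp [MSOAtom.of, pull, hg]
    · rcases hg' : g j with _ | b
      · simp [MSOAtom.of, pull, hg']
      · simpa [MSOAtom.of, pull, hg, hg'] using h3 a b

theorem of_pull {q : ℕ} (g : κ → Option ι) {G : SimpleGraph V} {S : ι → Set V}
    {H : SimpleGraph W} {R : ι → Set W} (h : of q G S = of q H R) :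
    of q G (pull g S) = of q H (pull g R) := by
  induction q generalizing ι κ with
  | zero => exact MSOAtom.of_pull g h
  | succ q ih =>
    rw [of_succ_eq_iff] at h ⊢
    have key : ∀ {U : Type} (T : ι → Set U) (A : Set U), ext (pull g T) A =
        pull (fun o : Option κ => o.elim (some none) fun k => (g k).map some) (ext T A) := by
      intro U T A
      funext o
      rcases o with _ | k
      · rfl
      · simp only [ext, pull, Option.elim]
        rcases g k with _ | a <;> rfl
    refine ⟨MSOAtom.of_pull g h.1, fun A => ?_, fun B => ?_⟩
    · obtain ⟨B, hB⟩ := h.2.1 A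
      exact ⟨B, by rw [key, key]; exact ih _ hB⟩
    · obtain ⟨A, hA⟩ := h.2.2 B
      exact ⟨A, by rw [key, key]; exact ih _ hA⟩

/-- The graph obtained by adding all edges between two vertex sets. -/
def _root_.SimpleGraph.joinSets (G : SimpleGraph V) (A B : Set V) : SimpleGraph V where
  Adj x y := G.Adj x y ∨ (x ≠ y ∧ (x ∈ A ∧ y ∈ B ∨ x ∈ B ∧ y ∈ A))
  symm := ⟨fun x y h => by
    rcases h with h | ⟨h, h'⟩
    · exact Or.inl h.symm
    · exact Or.inr ⟨h.symm, by tauto⟩⟩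
  loopless := ⟨fun x h => by
    rcases h with h | ⟨h, -⟩
    · exact G.loopless.irrefl x h
    · exact h rfl⟩

theorem _root_.MSOAtom.adj_joinSets {G : SimpleGraph V} {S : ι → Set V} {i j : ι}
    (hd : Disjoint (S i) (S j)) (a b : ι) :
    (MSOAtom.of (G.joinSets (S i) (S j)) S).adj a b ↔ (MSOAtom.of G S).adj a b ∨
      ((MSOAtom.of G S).inter a i ∧ (MSOAtom.of G S).inter b j) ∨
      ((MSOAtom.of G S).inter a j ∧ (MSOAtom.of G S).inter b i) := by
  have hne : ∀ x ∈ S i, ∀ y ∈ S j, x ≠ y := fun x hx y hy =>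
    Set.disjoint_iff_forall_ne.1 hd hx hy
  simp only [MSOAtom.of, SimpleGraph.joinSets]
  constructor
  · rintro ⟨x, hx, y, hy, h | ⟨-, h | h⟩⟩
    · exact Or.inl ⟨x, hx, y, hy, h⟩
    · exact Or.inr (Or.inl ⟨⟨x, hx, h.1⟩, ⟨y, hy, h.2⟩⟩)
    · exact Or.inr (Or.inr ⟨⟨x, hx, h.1⟩, ⟨y, hy, h.2⟩⟩)
  · rintro (⟨x, hx, y, hy, h⟩ | ⟨⟨x, hx, h1⟩, ⟨y, hy, h2⟩⟩ | ⟨⟨x, hx, h1⟩, ⟨y, hy, h2⟩⟩)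
    · exact ⟨x, hx, y, hy, Or.inl h⟩
    · exact ⟨x, hx, y, hy, Or.inr ⟨hne x h1 y h2, Or.inl ⟨h1, h2⟩⟩⟩
    · exact ⟨x, hx, y, hy, Or.inr ⟨(hne y h2 x h1).symm, Or.inr ⟨h1, h2⟩⟩⟩

theorem of_joinSets {q : ℕ} {i j : ι} {G : SimpleGraph V} {S : ι → Set V} {H : SimpleGraph W}
    {R : ι → Set W} (hS : Disjoint (S i) (S j)) (hR : Disjoint (R i) (R j))
    (h : of q G S = of q H R) :
    of q (G.joinSets (S i) (S j)) S = of q (H.joinSets (R i) (R j)) R := by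
  have hatom : ∀ h' : MSOAtom.of G S = MSOAtom.of H R,
      MSOAtom.of (G.joinSets (S i) (S j)) S = MSOAtom.of (H.joinSets (R i) (R j)) R := by
    intro h'
    have h1 : (MSOAtom.of G S).sing = _ := congrArg MSOAtom.sing h'
    have h2 : (MSOAtom.of G S).inter = _ := congrArg MSOAtom.inter h'
    refine MSOAtom.ext h1 h2 (funext fun a => funext fun b => propext ?_)
    rw [MSOAtom.adj_joinSets hS, MSOAtom.adj_joinSets hR, h']
  induction q generalizing ι with
  | zero => exact hatom h
  | succ q ih =>
    have h' := atom_eq h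
    rw [of_succ_eq_iff] at h ⊢
    have step : ∀ A B, of q G (ext S A) = of q H (ext R B) →
        of q (G.joinSets (S i) (S j)) (ext S A) = of q (H.joinSets (R i) (R j)) (ext R B) := by
      intro A B hAB
      refine ih (i := some i) (j := some j) hS hR hAB fun h'' => ?_
      have h1 : (MSOAtom.of G (ext S A)).sing = _ := congrArg MSOAtom.sing h''
      have h2 : (MSOAtom.of G (ext S A)).inter = _ := congrArg MSOAtom.inter h''
      refine MSOAtom.ext h1 h2 (funext fun a => funext fun b => propext ?_)
      rw [MSOAtom.adj_joinSets (i := some i) (j := some j) hS,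
        MSOAtom.adj_joinSets (i := some i) (j := some j) hR, h'']
    refine ⟨hatom h', fun A => ?_, fun B => ?_⟩
    · obtain ⟨B, hB⟩ := h.2.1 A
      exact ⟨B, step A B hB⟩
    · obtain ⟨A, hA⟩ := h.2.2 B
      exact ⟨A, step A B hA⟩

end MSOType

/-- The quantifier rank of a formula. -/
def MSOFormula.rank : {k l : ℕ} → MSOFormula k l → ℕ
  | _, _, .mem _ _ => 0
  | _, _, .adj _ _ => 0
  | _, _, .eq _ _ => 0
  | _, _, .and φ ψ => max φ.rank ψ.rank
  | _, _, .or φ ψ => max φ.rank ψ.rank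
  | _, _, .not φ => φ.rank
  | _, _, .all φ => φ.rank + 1
  | _, _, .ex φ => φ.rank + 1
  | _, _, .allSet φ => φ.rank + 1
  | _, _, .exSet φ => φ.rank + 1

namespace MSOType
variable {ι V W : Type}

theorem snoc_singleton {k : ℕ} {S : ι → Set V} {v : Fin k → V} {e : Fin k → ι}
    (he : ∀ i, S (e i) = {v i}) (a : V) (i : Fin (k + 1)) :
    ext S {a} ((Fin.snoc (fun i => some (e i)) none : Fin (k + 1) → Option ι) i) =
      {(Fin.snoc v a : Fin (k + 1) → V) i} := by
  refine Fin.lastCases ?_ (fun i => ?_) i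
  · simp [ext]
  · simp [ext, he]

theorem snoc_set {l : ℕ} {S : ι → Set V} {Z : Fin l → Set V} {f : Fin l → ι}
    (hf : ∀ i, S (f i) = Z i) (A : Set V) (i : Fin (l + 1)) :
    ext S A ((Fin.snoc (fun i => some (f i)) none : Fin (l + 1) → Option ι) i) =
      (Fin.snoc Z A : Fin (l + 1) → Set V) i := by
  refine Fin.lastCases ?_ (fun i => ?_) i
  · simp [ext]
  · simp [ext, hf]

/-- A response to a singleton move is a singleton. -/
theorem exists_singleton {q : ℕ} {G : SimpleGraph V} {S : ι → Set V} {H : SimpleGraph W}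
    {R : ι → Set W} (h : of (q + 1) G S = of (q + 1) H R) (a : V) :
    ∃ b, of q G (ext S {a}) = of q H (ext R {b}) := by
  obtain ⟨B, hB⟩ := (of_succ_eq_iff.1 h).2.1 {a}
  have h1 := congrFun (congrArg MSOAtom.sing (atom_eq hB)) none
  obtain ⟨b, hb⟩ : ∃ b, ext R B none = {b} := h1.mp ⟨a, rfl⟩
  have hb' : B = {b} := hb
  exact ⟨b, hb' ▸ hB⟩

/-- Structures of the same rank-`q` type satisfy the same formulas of rank at most `q`. -/
theorem realize_iff {k l : ℕ} (φ : MSOFormula k l) {ι : Type} {q : ℕ} (hq : φ.rank ≤ q)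
    {G : SimpleGraph V} {S : ι → Set V} {H : SimpleGraph W} {R : ι → Set W}
    (h : of q G S = of q H R) {e : Fin k → ι} {f : Fin l → ι}
    {v : Fin k → V} {w : Fin k → W} {X : Fin l → Set V} {Y : Fin l → Set W}
    (hv : ∀ i, S (e i) = {v i}) (hw : ∀ i, R (e i) = {w i})
    (hX : ∀ i, S (f i) = X i) (hY : ∀ i, R (f i) = Y i) :
    φ.Realize G v X ↔ φ.Realize H w Y := by
  induction φ generalizing ι q with
  | mem x Z =>
    have h2 := congrFun (congrFun (congrArg MSOAtom.inter (atom_eq h)) (e x)) (f Z)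
    simpa [MSOAtom.of, hv, hw, hX, hY, MSOFormula.Realize] using h2
  | adj x y =>
    have h2 := congrFun (congrFun (congrArg MSOAtom.adj (atom_eq h)) (e x)) (e y)
    simpa [MSOAtom.of, hv, hw, MSOFormula.Realize] using h2
  | eq x y =>
    have h2 := congrFun (congrFun (congrArg MSOAtom.inter (atom_eq h)) (e x)) (e y)
    simpa [MSOAtom.of, hv, hw, MSOFormula.Realize, eq_comm] using h2
  | and φ ψ ih1 ih2 =>
    simp only [MSOFormula.rank, max_le_iff] at hq
    exact and_congr (ih1 hq.1 h hv hw hX hY) (ih2 hq.2 h hv hw hX hY)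
  | or φ ψ ih1 ih2 =>
    simp only [MSOFormula.rank, max_le_iff] at hq
    exact or_congr (ih1 hq.1 h hv hw hX hY) (ih2 hq.2 h hv hw hX hY)
  | not φ ih => exact not_congr (ih hq h hv hw hX hY)
  | all φ ih =>
    obtain ⟨q, rfl⟩ : ∃ r, q = r + 1 := ⟨q - 1, by simp only [MSOFormula.rank] at hq; omega⟩
    simp only [MSOFormula.rank, add_le_add_iff_right] at hq
    have step := fun a b (hab : of q G (ext S {a}) = of q H (ext R {b})) =>
      ih hq hab (snoc_singleton hv a) (snoc_singleton hw b) (f := fun i => some (f i)) hX hY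
    constructor
    · intro hφ b
      obtain ⟨a, ha⟩ := exists_singleton h.symm b
      exact (step a b ha.symm).1 (hφ a)
    · intro hφ a
      obtain ⟨b, hb⟩ := exists_singleton h a
      exact (step a b hb).2 (hφ b)
  | ex φ ih =>
    obtain ⟨q, rfl⟩ : ∃ r, q = r + 1 := ⟨q - 1, by simp only [MSOFormula.rank] at hq; omega⟩
    simp only [MSOFormula.rank, add_le_add_iff_right] at hq
    have step := fun a b (hab : of q G (ext S {a}) = of q H (ext R {b})) =>
      ih hq hab (snoc_singleton hv a) (snoc_singleton hw b) (f := fun i => some (f i)) hX hY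
    constructor
    · rintro ⟨a, hφ⟩
      obtain ⟨b, hb⟩ := exists_singleton h a
      exact ⟨b, (step a b hb).1 hφ⟩
    · rintro ⟨b, hφ⟩
      obtain ⟨a, ha⟩ := exists_singleton h.symm b
      exact ⟨a, (step a b ha.symm).2 hφ⟩
  | allSet φ ih =>
    obtain ⟨q, rfl⟩ : ∃ r, q = r + 1 := ⟨q - 1, by simp only [MSOFormula.rank] at hq; omega⟩
    simp only [MSOFormula.rank, add_le_add_iff_right] at hq
    have step := fun A B (hab : of q G (ext S A) = of q H (ext R B)) =>
      ih hq hab (e := fun i => some (e i)) hv hw (snoc_set hX A) (snoc_set hY B)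
    rw [of_succ_eq_iff] at h
    constructor
    · intro hφ B
      obtain ⟨A, hA⟩ := h.2.2 B
      exact (step A B hA).1 (hφ A)
    · intro hφ A
      obtain ⟨B, hB⟩ := h.2.1 A
      exact (step A B hB).2 (hφ B)
  | exSet φ ih =>
    obtain ⟨q, rfl⟩ : ∃ r, q = r + 1 := ⟨q - 1, by simp only [MSOFormula.rank] at hq; omega⟩
    simp only [MSOFormula.rank, add_le_add_iff_right] at hq
    have step := fun A B (hab : of q G (ext S A) = of q H (ext R B)) =>
      ih hq hab (e := fun i => some (e i)) hv hw (snoc_set hX A) (snoc_set hY B)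
    rw [of_succ_eq_iff] at h
    constructor
    · rintro ⟨A, hφ⟩
      obtain ⟨B, hB⟩ := h.2.1 A
      exact ⟨B, (step A B hB).1 hφ⟩
    · rintro ⟨B, hφ⟩
      obtain ⟨A, hA⟩ := h.2.2 B
      exact ⟨A, (step A B hA).2 hφ⟩

/-- The rank-`q` type of a graph without distinguished sets. -/
abbrev ofGraph (q : ℕ) (G : SimpleGraph V) : MSOType q Empty := of q G Empty.elim

theorem satisfiesMSO_iff {φ : MSOSentence} {G : SimpleGraph V} {H : SimpleGraph W}
    (h : ofGraph φ.rank G = ofGraph φ.rank H) : SatisfiesMSO G φ ↔ SatisfiesMSO H φ :=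
  realize_iff φ le_rfl h (e := Fin.elim0) (f := Fin.elim0) (fun i => i.elim0) (fun i => i.elim0)
    (fun i => i.elim0) (fun i => i.elim0)

theorem ofGraph_iso (q : ℕ) {G : SimpleGraph V} {H : SimpleGraph W} (e : G ≃g H) :
    ofGraph q H = ofGraph q G := by
  rw [ofGraph, of_iso q e]
  congr 1
  funext i
  exact i.elim

theorem ofGraph_sum (q : ℕ) (G : SimpleGraph V) (H : SimpleGraph W) :
    ofGraph q (G ⊕g H) = ofGraph q G + ofGraph q H := by
  rw [← of_sum]
  unfold ofGraph
  congr 1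
  funext i
  exact i.elim

/-- Equality of types is preserved when the distinguished sets are forgotten. -/
theorem ofGraph_eq_of_eq {q : ℕ} {G : SimpleGraph V} {S : ι → Set V} {H : SimpleGraph W}
    {R : ι → Set W} (h : of q G S = of q H R) : ofGraph q G = ofGraph q H := by
  have := of_pull (κ := Empty) (fun k => k.elim) h
  refine Eq.trans ?_ (this.trans ?_) <;>
  · unfold ofGraph
    congr 1
    funext i
    exact i.elim

end MSOType

/-! ### Disjoint unions and decomposable classes -/

namespace SimpleGraph

variable {V W : Type*}

/-- If the range of an embedding is a union of components, then reachability can be pulled back. -/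
theorem Reachable.exists_of_closed_range {G : SimpleGraph V} {H : SimpleGraph W} (f : H ↪g G)
    (hf : ∀ x y, G.Adj (f x) y → y ∈ Set.range f) {x : W} {y : V} (h : G.Reachable (f x) y) :
    ∃ z, f z = y ∧ H.Reachable x z := by
  obtain ⟨p⟩ := h
  generalize hu : f x = u at p
  induction p generalizing x with
  | nil => exact ⟨x, hu, Reachable.refl _⟩
  | cons h p ih =>
    subst hu
    obtain ⟨z, rfl⟩ := hf _ _ h
    obtain ⟨w, hw, hr⟩ := ih rfl
    exact ⟨w, hw, (f.map_adj_iff.1 h).reachable.trans hr⟩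

theorem nonempty_component_iso {G : SimpleGraph V} {H : SimpleGraph W} (f : H ↪g G)
    (hf : ∀ x y, G.Adj (f x) y → y ∈ Set.range f) (x : W) :
    Nonempty ((H.connectedComponentMk x).toSimpleGraph ≃g
      (G.connectedComponentMk (f x)).toSimpleGraph) := by
  refine ⟨⟨Equiv.ofBijective (fun z => ⟨f z.1, ?_⟩) ⟨?_, ?_⟩, ?_⟩⟩
  · have := ConnectedComponent.exact z.2
    exact ConnectedComponent.sound (this.map f.toHom)
  · intro a b h
    exact Subtype.ext (f.injective (congrArg Subtype.val h))
  · rintro ⟨y, hy⟩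
    obtain ⟨z, rfl, hz⟩ := (ConnectedComponent.exact hy).symm.exists_of_closed_range f hf
    exact ⟨⟨z, ConnectedComponent.sound hz.symm⟩, rfl⟩
  · intro a b
    exact f.map_adj_iff

/-- A graph without edges between `S` and its complement is the disjoint union of the graphs
induced on `S` and on the complement. -/
noncomputable def sumIsoOfNoCross {V : Type} (G : SimpleGraph V) (S : Set V)
    (h : ∀ x ∈ S, ∀ y ∉ S, ¬ G.Adj x y) : G.induce S ⊕g G.induce Sᶜ ≃g G :=
  haveI := Classical.decPred (· ∈ S)
  ⟨Equiv.Set.sumCompl S, by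
    rintro (⟨a, ha⟩ | ⟨a, ha⟩) (⟨b, hb⟩ | ⟨b, hb⟩)
    · simp
    · simpa using h a ha b hb
    · simpa using fun h' => h b hb a ha (G.adj_symm h')
    · simp⟩

end SimpleGraph

namespace GraphClass

variable {C : GraphClass} {V W : Type} [Finite V] [Finite W]

theorem mem_iso (C : GraphClass) {G : SimpleGraph V} {H : SimpleGraph W} (e : G ≃g H) :
    C.Mem G ↔ C.Mem H :=
  ⟨C.iso_closed G H ⟨e⟩, C.iso_closed H G ⟨e.symm⟩⟩

theorem Decomposable.mem_sum (hC : C.Decomposable) (G : SimpleGraph V) (H : SimpleGraph W) :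
    C.Mem (G ⊕g H) ↔ C.Mem G ∧ C.Mem H := by
  have hl : ∀ x y, (G ⊕g H).Adj (SimpleGraph.Embedding.sumInl (G := G) (H := H) x) y →
      y ∈ Set.range (SimpleGraph.Embedding.sumInl (G := G) (H := H)) := by
    rintro x (y | y) h
    · exact ⟨y, rfl⟩
    · simp at h
  have hr : ∀ x y, (G ⊕g H).Adj (SimpleGraph.Embedding.sumInr (G := G) (H := H) x) y →
      y ∈ Set.range (SimpleGraph.Embedding.sumInr (G := G) (H := H)) := by
    rintro x (y | y) h
    · simp at h
    · exact ⟨y, rfl⟩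
  rw [hC, hC V G, hC W H]
  constructor
  · intro h
    constructor
    · intro c
      induction c using SimpleGraph.ConnectedComponent.ind with
      | _ x => exact (C.mem_iso (SimpleGraph.nonempty_component_iso _ hl x).some).2 (h _)
    · intro c
      induction c using SimpleGraph.ConnectedComponent.ind with
      | _ x => exact (C.mem_iso (SimpleGraph.nonempty_component_iso _ hr x).some).2 (h _)
  · rintro ⟨h1, h2⟩ c
    induction c using SimpleGraph.ConnectedComponent.ind with
    | _ x =>
      rcases x with x | x
      · exact (C.mem_iso (SimpleGraph.nonempty_component_iso _ hl x).some).1 (h1 _)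
      · exact (C.mem_iso (SimpleGraph.nonempty_component_iso _ hr x).some).1 (h2 _)

theorem Decomposable.mem_of_noCross (hC : C.Decomposable) {G : SimpleGraph V} {S : Set V}
    (h : ∀ x ∈ S, ∀ y ∉ S, ¬ G.Adj x y) :
    C.Mem G ↔ C.Mem (G.induce S) ∧ C.Mem (G.induce Sᶜ) := by
  rw [← hC.mem_sum]
  exact (C.mem_iso (G.sumIsoOfNoCross S h)).symm

theorem Decomposable.mem_of_isEmpty (hC : C.Decomposable) [IsEmpty V] (G : SimpleGraph V) :
    C.Mem G :=
  (hC V G).2 fun c => isEmptyElim c.nonempty_supp.some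

end GraphClass

/-! ### Attaching rooted graphs -/

/-- A finite graph with a distinguished vertex. -/
structure RootedGraph where
  V : Type
  [fin : Finite V]
  G : SimpleGraph V
  root : V

attribute [instance] RootedGraph.fin

namespace RootedGraph

/-- The disjoint union of `A` and `B` with an additional edge between the roots, rooted at the root
of `A`. -/
abbrev attach (A B : RootedGraph) : RootedGraph where
  V := A.V ⊕ B.V
  G := (A.G ⊕g B.G) ⊔ SimpleGraph.edge (Sum.inl A.root) (Sum.inr B.root)
  root := Sum.inl A.root

/-- The graphs of the list `L`, all attached to the root of `A`. -/
def hub (A : RootedGraph) : List RootedGraph → RootedGraph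
  | [] => A
  | B :: L => (hub A L).attach B

/-- A connected member of the class, with some root. -/
def IsConnectedMember (C : GraphClass) (A : RootedGraph) : Prop :=
  C.Mem A.G ∧ A.G.Connected

variable {C : GraphClass} {A B : RootedGraph}

theorem attach_adj_inl_inl {x y : A.V} :
    (A.attach B).G.Adj (Sum.inl x) (Sum.inl y) ↔ A.G.Adj x y := by
  simp [attach, SimpleGraph.edge_adj]

theorem attach_adj_inr_inr {x y : B.V} :
    (A.attach B).G.Adj (Sum.inr x) (Sum.inr y) ↔ B.G.Adj x y := by
  simp [attach, SimpleGraph.edge_adj]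

theorem attach_adj_inl_inr {x : A.V} {y : B.V} :
    (A.attach B).G.Adj (Sum.inl x) (Sum.inr y) ↔ x = A.root ∧ y = B.root := by
  simp [attach, SimpleGraph.edge_adj]

theorem attach_adj_inr_inl {x : B.V} {y : A.V} :
    (A.attach B).G.Adj (Sum.inr x) (Sum.inl y) ↔ y = A.root ∧ x = B.root := by
  rw [SimpleGraph.adj_comm, attach_adj_inl_inr]

theorem attach_connected (hA : A.G.Connected) (hB : B.G.Connected) :
    (A.attach B).G.Connected := by
  let f : A.G →g (A.attach B).G := ⟨Sum.inl, fun h => attach_adj_inl_inl.2 h⟩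
  let g : B.G →g (A.attach B).G := ⟨Sum.inr, fun h => attach_adj_inr_inr.2 h⟩
  have hroot : ∀ z, (A.attach B).G.Reachable z (Sum.inl A.root) := by
    rintro (x | x)
    · exact (hA.preconnected x A.root).map f
    · have h1 : (A.attach B).G.Reachable (Sum.inr x) (Sum.inr B.root) :=
        (hB.preconnected x B.root).map g
      have h2 : (A.attach B).G.Adj (Sum.inr B.root) (Sum.inl A.root) :=
        attach_adj_inr_inl.2 ⟨rfl, rfl⟩
      exact h1.trans h2.reachable
  have : Nonempty (A.attach B).V := ⟨Sum.inl A.root⟩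
  exact ⟨fun x y => (hroot x).trans (hroot y).symm⟩

theorem mem_attach (hC : C.Addable) (hA : C.Mem A.G) (hB : C.Mem B.G) :
    C.Mem (A.attach B).G := by
  refine hC.2 _ _ ((hC.1.mem_sum A.G B.G).2 ⟨hA, hB⟩) _ _ fun h => ?_
  have hl : ∀ x y, (A.G ⊕g B.G).Adj (SimpleGraph.Embedding.sumInl (G := A.G) (H := B.G) x) y →
      y ∈ Set.range (SimpleGraph.Embedding.sumInl (G := A.G) (H := B.G)) := by
    rintro x (y | y) h
    · exact ⟨y, rfl⟩
    · simp at h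
  obtain ⟨z, hz, -⟩ := (SimpleGraph.ConnectedComponent.exact h).exists_of_closed_range
    SimpleGraph.Embedding.sumInl hl
  cases hz

theorem IsConnectedMember.attach (hC : C.Addable) (hA : A.IsConnectedMember C)
    (hB : B.IsConnectedMember C) : (A.attach B).IsConnectedMember C :=
  ⟨mem_attach hC hA.1 hB.1, attach_connected hA.2 hB.2⟩

theorem IsConnectedMember.hub (hC : C.Addable) (hA : A.IsConnectedMember C)
    {L : List RootedGraph} (hL : ∀ B ∈ L, B.IsConnectedMember C) :
    (A.hub L).IsConnectedMember C := by
  induction L with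
  | nil => exact hA
  | cons B L ih =>
    exact (ih fun B' h => hL B' (List.mem_cons_of_mem _ h)).attach hC (hL B List.mem_cons_self)

/-! ### Types of graphs with many attached copies -/

/-- The two vertex sets used to describe a hub: the root and the set of attached roots. -/
def mark {V : Type} (X Y : Set V) : Bool → Set V := fun b => cond b Y X

/-- The graph `A.hub L` without the edges between the root and the attached graphs, together with
the set of the roots of the attached graphs. -/
def hubCore (A : RootedGraph) : (L : List RootedGraph) →
    SimpleGraph (A.hub L).V × Set (A.hub L).V
  | [] => (A.G, ∅)
  | B :: L => ((hubCore A L).1 ⊕g B.G,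
      {x : (A.hub L).V ⊕ B.V | Sum.elim (· ∈ (hubCore A L).2) (· = B.root) x})

theorem root_notMem_hubCore (A : RootedGraph) (L : List RootedGraph) :
    (A.hub L).root ∉ (A.hubCore L).2 := by
  induction L with
  | nil => exact Set.notMem_empty _
  | cons B L ih => exact ih

theorem attach_eq_joinSets {G : SimpleGraph A.V} {Y : Set A.V}
    (h : A.G = G.joinSets {A.root} Y) :
    (A.attach B).G = (G ⊕g B.G).joinSets {Sum.inl A.root}
      {x | Sum.elim (· ∈ Y) (· = B.root) x} := by
  ext x y
  rcases x with x | x <;> rcases y with y | y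
  · rw [attach_adj_inl_inl, h]
    simp [SimpleGraph.joinSets]
  · rw [attach_adj_inl_inr]
    simp [SimpleGraph.joinSets]
  · rw [attach_adj_inr_inl]
    simp [SimpleGraph.joinSets, and_comm]
  · rw [attach_adj_inr_inr]
    simp [SimpleGraph.joinSets]

theorem hub_eq_joinSets (A : RootedGraph) (L : List RootedGraph) :
    (A.hub L).G = (A.hubCore L).1.joinSets {(A.hub L).root} (A.hubCore L).2 := by
  induction L with
  | nil =>
    ext x y
    change A.G.Adj x y ↔ A.G.Adj x y ∨ _
    refine ⟨Or.inl, ?_⟩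
    rintro (h | ⟨-, ⟨-, h⟩ | ⟨h, -⟩⟩)
    exacts [h, absurd h (Set.notMem_empty _), absurd h (Set.notMem_empty _)]
  | cons B L ih => exact attach_eq_joinSets ih

/-- The type of a rooted graph, as a graph with one distinguished set. -/
def rootedType (q : ℕ) (A : RootedGraph) : MSOType q Unit :=
  MSOType.of q A.G fun _ => {A.root}

/-- The type of a rooted graph in the role of an attached graph. -/
def attachedType (q : ℕ) (A : RootedGraph) : MSOType q Bool :=
  MSOType.of q A.G (mark ∅ {A.root})

theorem attachedType_eq {q : ℕ} (h : A.rootedType q = B.rootedType q) :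
    A.attachedType q = B.attachedType q := by
  have := MSOType.of_pull (κ := Bool) (fun b => cond b (some ()) none) h
  have key : ∀ D : RootedGraph, mark ∅ {D.root} =
      MSOType.pull (κ := Bool) (fun b => cond b (some ()) none) fun _ : Unit => {D.root} := by
    intro D
    funext b
    cases b <;> rfl
  rw [attachedType, attachedType, key, key]
  exact this

theorem mark_attach (A B : RootedGraph) (Y : Set A.V) :
    mark {(Sum.inl A.root : A.V ⊕ B.V)} {x | Sum.elim (· ∈ Y) (· = B.root) x} =
      MSOType.sumSets (mark {A.root} Y) (mark ∅ {B.root}) := by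
  funext b
  ext x
  rcases b with _ | _ <;> rcases x with x | x <;> simp [mark]

theorem of_hubCore (q : ℕ) (A : RootedGraph) (L : List RootedGraph) :
    MSOType.of q (A.hubCore L).1 (mark {(A.hub L).root} (A.hubCore L).2) =
      (L.map (attachedType q)).sum + MSOType.of q A.G (mark {A.root} ∅) := by
  induction L with
  | nil => rw [List.map_nil, List.sum_nil, zero_add]; rfl
  | cons B L ih =>
    rw [List.map_cons, List.sum_cons, add_assoc, ← ih, add_comm, attachedType, ← MSOType.of_sum]
    change MSOType.of q ((A.hubCore L).1 ⊕g B.G) _ = _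
    congr 1
    exact mark_attach _ _ _

theorem rootedType_hub_eq {q : ℕ} {L L' : List RootedGraph}
    (h : (L.map (attachedType q)).sum = (L'.map (attachedType q)).sum) :
    (A.hub L).rootedType q = (A.hub L').rootedType q := by
  have h1 : MSOType.of q (A.hubCore L).1 (mark {(A.hub L).root} (A.hubCore L).2) =
      MSOType.of q (A.hubCore L').1 (mark {(A.hub L').root} (A.hubCore L').2) := by
    rw [of_hubCore, of_hubCore, h]
  have h2 := MSOType.of_joinSets (i := false) (j := true)
    (S := mark {(A.hub L).root} (A.hubCore L).2) (R := mark {(A.hub L').root} (A.hubCore L').2)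
    (Set.disjoint_singleton_left.2 (root_notMem_hubCore A L))
    (Set.disjoint_singleton_left.2 (root_notMem_hubCore A L')) h1
  have h3 := MSOType.of_pull (κ := Unit) (fun _ => some false) h2
  rw [rootedType, rootedType, hub_eq_joinSets, hub_eq_joinSets]
  exact h3

theorem ofGraph_attach_eq {q : ℕ} {B' : RootedGraph} (h : B.rootedType q = B'.rootedType q) :
    MSOType.ofGraph q (A.attach B).G = MSOType.ofGraph q (A.attach B').G :=
  MSOType.ofGraph_eq_of_eq (rootedType_hub_eq (A := A) (L := [B]) (L' := [B'])
    (by simp [attachedType_eq h]))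

/-- The graph `F` – `P` – `M` with its two connecting edges, read in two ways. -/
def attachRotate (F P M : RootedGraph) :
    (F.attach (P.attach M)).G ≃g
      (M.attach ⟨(F.attach P).V, (F.attach P).G, Sum.inr P.root⟩).G where
  toEquiv := (Equiv.sumAssoc F.V P.V M.V).symm.trans (Equiv.sumComm _ _)
  map_rel_iff' := by
    rintro (x | x | x) (y | y | y)
    · exact attach_adj_inr_inr.trans (attach_adj_inl_inl.trans attach_adj_inl_inl.symm)
    · refine attach_adj_inr_inr.trans (attach_adj_inl_inr.trans
        (Iff.trans ?_ attach_adj_inl_inr.symm))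
      simp
    · refine attach_adj_inr_inl.trans (Iff.trans ?_ attach_adj_inl_inr.symm)
      simp
    · refine attach_adj_inr_inr.trans (attach_adj_inr_inl.trans
        (Iff.trans ?_ attach_adj_inr_inl.symm))
      simp
    · exact attach_adj_inr_inr.trans (attach_adj_inr_inr.trans
        (attach_adj_inl_inl.symm.trans attach_adj_inr_inr.symm))
    · refine attach_adj_inr_inl.trans (Iff.trans ?_
        (attach_adj_inl_inr.symm.trans attach_adj_inr_inr.symm))
      simp [and_comm]
    · refine attach_adj_inl_inr.trans (Iff.trans ?_ attach_adj_inr_inl.symm)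
      simp
    · refine attach_adj_inl_inr.trans (Iff.trans ?_
        (attach_adj_inr_inl.symm.trans attach_adj_inr_inr.symm))
      simp [and_comm]
    · exact attach_adj_inl_inl.trans (attach_adj_inr_inr.symm.trans attach_adj_inr_inr.symm)

theorem exists_list_of_types (C : GraphClass) (q : ℕ) : ∃ L : List RootedGraph,
    (∀ B ∈ L, B.IsConnectedMember C) ∧ ∀ B : RootedGraph, B.IsConnectedMember C →
      ∃ B' ∈ L, B'.attachedType q = B.attachedType q := by
  obtain ⟨s, hs, hbij⟩ := Set.exists_subset_bijOn {B : RootedGraph | B.IsConnectedMember C}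
    (attachedType q)
  have hfin : s.Finite := Set.Finite.of_finite_image (Set.toFinite _) hbij.injOn
  refine ⟨hfin.toFinset.toList, fun B hB => hs (by simpa using hB), fun B hB => ?_⟩
  obtain ⟨B', hB', h⟩ := hbij.surjOn ⟨B, hB, rfl⟩
  exact ⟨B', by simpa using hB', h⟩

theorem sum_map_flatMap_replicate {q N : ℕ} (L : List RootedGraph) :
    ((L.flatMap (List.replicate N)).map (attachedType q)).sum =
      (L.map fun B => N • B.attachedType q).sum := by
  induction L with
  | nil => rfl
  | cons B L ih =>
    rw [List.flatMap_cons, List.map_append, List.sum_append, ih, List.map_cons, List.sum_cons,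
      List.map_replicate, List.sum_replicate]

/-- Let `M` consist of sufficiently many copies of all connected members of the class up to
equality of rooted types, attached to a common root, and let `P` consist of sufficiently many copies
of `M` attached to a common root. If a connected member `G` of the class arises by attaching `P`
somewhere, then `G` has the same type as `M`: joining `G` to `M` by an edge between the roots does
not change the type of `M`, which has many copies of a graph of the type of `G` already, and it does
not change the type of `G`, which has many copies of `M` already. The rest `F` of `G` need not
belong to the class. -/
theorem exists_absorbing {C : GraphClass} (hC : C.Addable) {A : RootedGraph}
    (hA : A.IsConnectedMember C) (q : ℕ) :
    ∃ (P : RootedGraph) (t : MSOType q Empty), P.IsConnectedMember C ∧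
      ∀ F : RootedGraph, C.Mem (F.attach P).G → (F.attach P).G.Connected →
        MSOType.ofGraph q (F.attach P).G = t := by
  obtain ⟨N, hN⟩ := MSOType.aperiodic q Bool
  obtain ⟨L, hL, hL'⟩ := exists_list_of_types C q
  set M := A.hub (L.flatMap (List.replicate N)) with hM
  have hMmem : M.IsConnectedMember C := hA.hub hC fun B hB => by
    obtain ⟨B', hB', h⟩ := List.mem_flatMap.1 hB
    rw [List.eq_of_mem_replicate h]
    exact hL B' hB'
  refine ⟨A.hub (List.replicate N M), MSOType.ofGraph q M.G, hA.hub hC fun B hB => ?_,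
    fun F hF hF' => ?_⟩
  · rw [List.eq_of_mem_replicate hB]
    exact hMmem
  set P := A.hub (List.replicate N M) with hP
  let D : RootedGraph := ⟨(F.attach P).V, (F.attach P).G, Sum.inr P.root⟩
  have h1 : MSOType.ofGraph q (M.attach D).G = MSOType.ofGraph q M.G := by
    obtain ⟨B', hB', hD⟩ := hL' D ⟨hF, hF'⟩
    refine MSOType.ofGraph_eq_of_eq (rootedType_hub_eq (A := A)
      (L := D :: L.flatMap (List.replicate N)) (L' := L.flatMap (List.replicate N)) ?_)
    rw [List.map_cons, List.sum_cons, sum_map_flatMap_replicate, ← hD]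
    obtain ⟨L₁, L₂, rfl⟩ := List.append_of_mem hB'
    rw [List.map_append, List.sum_append, List.map_cons, List.sum_cons, add_left_comm,
      ← add_assoc (B'.attachedType q), ← succ_nsmul', hN N le_rfl]
  have h2 : P.rootedType q = (P.attach M).rootedType q := by
    refine rootedType_hub_eq (A := A) (L := List.replicate N M) (L' := M :: List.replicate N M) ?_
    rw [List.map_cons, List.sum_cons, List.map_replicate, List.sum_replicate, ← succ_nsmul',
      hN N le_rfl]
  rw [ofGraph_attach_eq (A := F) h2, ← h1]
  exact (MSOType.ofGraph_iso q (attachRotate F P M)).symm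

end RootedGraph

/-! ### Exponential generating functions with smooth coefficients -/

/-- A sequence that is approximated arbitrarily well by convergent sequences converges. -/
theorem exists_tendsto_of_approx {x : ℕ → ℝ}
    (h : ∀ ε > 0, ∃ (y : ℕ → ℝ) (l : ℝ), Tendsto y atTop (𝓝 l) ∧ ∀ᶠ n in atTop, |x n - y n| ≤ ε) :
    ∃ l, Tendsto x atTop (𝓝 l) := by
  apply cauchySeq_tendsto_of_complete
  rw [Metric.cauchySeq_iff]
  intro ε hε
  obtain ⟨y, l, hy, hxy⟩ := h (ε / 8) (by positivity)
  have h2 := (Metric.tendsto_nhds.1 hy) (ε / 8) (by positivity)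
  obtain ⟨N, hN⟩ := eventually_atTop.1 (hxy.and h2)
  refine ⟨N, fun m hm n hn => ?_⟩
  have hm' := hN m hm
  have hn' := hN n hn
  rw [Real.dist_eq] at hm' hn' ⊢
  have := abs_le.1 hm'.1
  have := abs_le.1 hn'.1
  have := abs_lt.1 hm'.2
  have := abs_lt.1 hn'.2
  rw [abs_lt]
  constructor <;> linarith

theorem sum_antidiagonal_head {K n : ℕ} (h : K ≤ n) (f : ℕ × ℕ → ℝ) :
    ∑ p ∈ antidiagonal n, f p = ∑ j ∈ Finset.range K, f (n - j, j) +
      ∑ p ∈ antidiagonal n with K ≤ p.2, f p := by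
  rw [← Finset.sum_filter_not_add_sum_filter (antidiagonal n) (fun p => K ≤ p.2)]
  congr 1
  refine Finset.sum_nbij' (fun p => p.2) (fun j => (n - j, j)) ?_ ?_ ?_ ?_ ?_
  · intro p hp
    simp only [Finset.mem_filter, not_le] at hp
    simpa using hp.2
  · intro j hj
    simp only [Finset.mem_range] at hj
    simp only [Finset.mem_filter, mem_antidiagonal, not_le]
    omega
  · rintro ⟨a, b⟩ hp
    simp only [Finset.mem_filter, mem_antidiagonal] at hp
    simp only [Prod.mk.injEq, and_true]
    omega
  · intro j _
    rfl
  · rintro ⟨a, b⟩ hp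
    simp only [Finset.mem_filter, mem_antidiagonal] at hp
    have : n - b = a := by omega
    simp [this]

/-- The relations between the normalized counts `b` of all members and `c` of the connected
members of a smooth addable class: `exp_formula` compares coefficients in `x B' = x C' B`, and
`tail_le` bounds the number of pairs of vertices in distinct components. -/
structure SmoothPair (b c : ℕ → ℝ) (γ : ℝ) : Prop where
  b_nonneg : ∀ n, 0 ≤ b n
  c_nonneg : ∀ n, 0 ≤ c n
  b_zero : b 0 = 1
  exp_formula : ∀ n : ℕ, n * b n = ∑ p ∈ antidiagonal n, p.1 * c p.1 * b p.2
  tail_le : ∀ K n : ℕ,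
    K * ∑ p ∈ antidiagonal n with K ≤ p.2, p.1 * c p.1 * b p.2 ≤ 2 * n * b n
  b_ne_zero : ∀ᶠ n in atTop, b n ≠ 0
  ratio : Tendsto (fun n => b (n + 1) / b n) atTop (𝓝 γ)
  exists_c_pos : ∃ h : ℕ, 0 < h ∧ 0 < c h

namespace SmoothPair

variable {b c : ℕ → ℝ} {γ : ℝ}

theorem b_pos (H : SmoothPair b c γ) : ∀ᶠ n in atTop, 0 < b n :=
  H.b_ne_zero.mono fun n hn => lt_of_le_of_ne (H.b_nonneg n) hn.symm

theorem ratio_pow (H : SmoothPair b c γ) (j : ℕ) :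
    Tendsto (fun n => b (n + j) / b n) atTop (𝓝 (γ ^ j)) := by
  induction j with
  | zero =>
    refine tendsto_const_nhds.congr' ?_
    filter_upwards [H.b_ne_zero] with n hn
    simp [div_self hn]
  | succ j ih =>
    have h1 := (H.ratio.comp (tendsto_add_atTop_nat j)).mul ih
    rw [pow_succ']
    refine h1.congr' ?_
    filter_upwards [(tendsto_add_atTop_nat j).eventually H.b_ne_zero] with n hn
    simp only [Function.comp_apply]
    rw [div_mul_div_cancel₀ hn, add_assoc]

theorem γ_pos (H : SmoothPair b c γ) : 0 < γ := by
  obtain ⟨h, hh, hc⟩ := H.exists_c_pos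
  have hγ : 0 ≤ γ := ge_of_tendsto' H.ratio fun n => div_nonneg (H.b_nonneg _) (H.b_nonneg _)
  refine lt_of_le_of_ne hγ fun h0 => ?_
  have key : ∀ᶠ n in atTop, c h / 4 ≤ b (n + h) / b n := by
    filter_upwards [H.b_pos, eventually_ge_atTop h] with n hn hnh
    rw [le_div_iff₀ hn]
    have h1 := H.tail_le n (n + h)
    have h2 : (h : ℝ) * c h * b n ≤
        ∑ p ∈ antidiagonal (n + h) with n ≤ p.2, p.1 * c p.1 * b p.2 := by
      refine Finset.single_le_sum (f := fun p : ℕ × ℕ => (p.1 : ℝ) * c p.1 * b p.2)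
        (a := (h, n)) (fun p _ => ?_) ?_
      · exact mul_nonneg (mul_nonneg (Nat.cast_nonneg _) (H.c_nonneg _)) (H.b_nonneg _)
      · simp [add_comm]
    have h3 : (1 : ℝ) ≤ h := by exact_mod_cast hh
    have h4 : (h : ℝ) ≤ n := by exact_mod_cast hnh
    have h5 : (n : ℝ) * (h * c h * b n) ≤ 2 * (n + h : ℕ) * b (n + h) :=
      le_trans (mul_le_mul_of_nonneg_left h2 (Nat.cast_nonneg _)) h1
    push_cast at h5
    have hn0 : (0 : ℝ) < n := lt_of_lt_of_le (by linarith) h4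
    have h6 : (n : ℝ) * (c h * b n) ≤ n * (h * c h * b n) := by
      rw [mul_assoc]
      refine mul_le_mul_of_nonneg_left ?_ hn0.le
      exact le_mul_of_one_le_left (mul_nonneg hc.le hn.le) h3
    have h7 : 2 * ((n : ℝ) + h) * b (n + h) ≤ n * (4 * b (n + h)) := by
      have := mul_le_mul_of_nonneg_right h4 (H.b_nonneg (n + h))
      nlinarith
    have := le_of_mul_le_mul_left (h6.trans (h5.trans h7)) hn0
    linarith
  have hlim := ge_of_tendsto (H.ratio_pow h) key
  rw [← h0, zero_pow hh.ne'] at hlim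
  linarith

theorem ratio_sub (H : SmoothPair b c γ) (j : ℕ) :
    Tendsto (fun n => b (n - j) / b n) atTop (𝓝 ((γ⁻¹) ^ j)) := by
  rw [← tendsto_add_atTop_iff_nat j]
  have h := (H.ratio_pow j).inv₀ (pow_ne_zero _ H.γ_pos.ne')
  rw [← inv_pow] at h
  refine h.congr fun n => ?_
  rw [Nat.add_sub_cancel, inv_div]

/-- Up to a constant factor, `b` grows at least geometrically. -/
theorem exists_bound (H : SmoothPair b c γ) : ∃ B r : ℝ, 0 < r ∧ 0 ≤ B ∧ ∀ᶠ n in atTop, ∀ j ≤ n,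
    b (n - j) / b n ≤ B * r ^ j := by
  have hγ := H.γ_pos
  have hev : ∀ᶠ n in atTop, b n ≤ 2 / γ * b (n + 1) := by
    have h1 : ∀ᶠ n in atTop, γ / 2 < b (n + 1) / b n :=
      H.ratio.eventually (lt_mem_nhds (by linarith))
    filter_upwards [h1, H.b_pos] with n hn hb
    rw [lt_div_iff₀ hb] at hn
    rw [div_mul_eq_mul_div, le_div_iff₀ hγ]
    linarith
  obtain ⟨N, hN⟩ := eventually_atTop.1 (hev.and H.b_pos)
  set r := 2 / γ with hr
  have hr0 : 0 < r := by positivity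
  have hbN := (hN N le_rfl).2
  -- beyond `N` the growth is geometric with ratio at least `1 / r`
  have h1 : ∀ m, N ≤ m → ∀ i, b m ≤ r ^ i * b (m + i) := by
    intro m hm i
    induction i with
    | zero => simp
    | succ i ih =>
      refine ih.trans ?_
      rw [pow_succ, mul_assoc]
      exact mul_le_mul_of_nonneg_left (hN (m + i) (by omega)).1 (by positivity)
  set B := 1 + ∑ m ∈ Finset.range N, b m / (r ^ (N - m) * b N) with hB
  have hterm : ∀ m, 0 ≤ b m / (r ^ (N - m) * b N) := fun m =>
    div_nonneg (H.b_nonneg m) (by positivity)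
  have hB1 : 1 ≤ B := by
    have := Finset.sum_nonneg (s := Finset.range N) fun m _ => hterm m
    linarith
  refine ⟨B, r, hr0, by linarith, ?_⟩
  filter_upwards [eventually_ge_atTop N] with n hn j hj
  have hbn := (hN n hn).2
  rw [div_le_iff₀ hbn]
  rcases le_or_gt N (n - j) with h | h
  · have h2 := h1 (n - j) h j
    rw [Nat.sub_add_cancel hj] at h2
    refine h2.trans ?_
    rw [mul_assoc]
    exact le_mul_of_one_le_left (by positivity) hB1
  · have h2 : b (n - j) / (r ^ (N - (n - j)) * b N) ≤ B := by
      have := Finset.single_le_sum (s := Finset.range N) (fun m _ => hterm m)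
        (Finset.mem_range.2 h)
      linarith
    rw [div_le_iff₀ (by positivity)] at h2
    refine h2.trans ?_
    have h3 := h1 N le_rfl (n - N)
    rw [Nat.add_sub_cancel' hn] at h3
    rw [mul_assoc]
    refine mul_le_mul_of_nonneg_left ?_ (by linarith)
    calc r ^ (N - (n - j)) * b N ≤ r ^ (N - (n - j)) * (r ^ (n - N) * b n) :=
          mul_le_mul_of_nonneg_left h3 (by positivity)
      _ = r ^ j * b n := by
          rw [← mul_assoc, ← pow_add]
          congr 2
          omega

/-- The coefficients of `exp (-A)` for the power series `A` with coefficients `a`. -/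
noncomputable def expNeg (a : ℕ → ℝ) : ℕ → ℝ
  | 0 => 1
  | n + 1 => -(∑ k : Fin (n + 1), ((k : ℕ) + 1) * a (k + 1) * expNeg a (n - k)) / (n + 1)

theorem expNeg_rec (a : ℕ → ℝ) (n : ℕ) :
    n * expNeg a n = -∑ p ∈ antidiagonal n, p.1 * a p.1 * expNeg a p.2 := by
  cases n with
  | zero => simp
  | succ n =>
    rw [Finset.Nat.antidiagonal_succ, Finset.sum_cons, Finset.sum_map,
      Finset.Nat.sum_antidiagonal_eq_sum_range_succ_mk, expNeg, Finset.sum_range]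
    have : ((n : ℝ) + 1) ≠ 0 := by positivity
    push_cast
    rw [mul_div_cancel₀ _ this]
    simp

theorem expNeg_bounded {a : ℕ → ℝ} (ha : ∀ k, 0 ≤ a k) {K : ℕ} (hK : ∀ k, K < k → a k = 0)
    {s : ℝ} (hs : 0 < s) : ∃ M, ∀ n, |expNeg a n| * s ^ n ≤ M := by
  set B := ∑ k ∈ Finset.range (K + 1), k * a k * s ^ k with hB
  obtain ⟨N, hN⟩ := exists_nat_ge B
  set N' := max N K with hN'
  set M := ∑ j ∈ Finset.range (N' + 1), |expNeg a j| * s ^ j with hM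
  have hterm : ∀ j, 0 ≤ |expNeg a j| * s ^ j := fun j => by positivity
  have hM0 : 0 ≤ M := Finset.sum_nonneg fun j _ => hterm j
  refine ⟨M, fun n => ?_⟩
  induction n using Nat.strong_induction_on with
  | _ n ih =>
    rcases le_or_gt n N' with h | h
    · exact Finset.single_le_sum (fun j _ => hterm j) (Finset.mem_range.2 (by omega))
    · have hn : (0 : ℝ) < n := by exact_mod_cast (by omega : 0 < n)
      have h1 : n * (|expNeg a n| * s ^ n) ≤
          ∑ p ∈ antidiagonal n, (p.1 * a p.1 * s ^ p.1) * M := by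
        have h2 : n * (|expNeg a n| * s ^ n) = |n * expNeg a n| * s ^ n := by
          rw [abs_mul, Nat.abs_cast, mul_assoc]
        rw [h2, expNeg_rec, abs_neg]
        refine (mul_le_mul_of_nonneg_right (Finset.abs_sum_le_sum_abs _ _) (by positivity)).trans ?_
        rw [Finset.sum_mul]
        refine Finset.sum_le_sum fun p hp => ?_
        have hp' := mem_antidiagonal.1 hp
        rw [abs_mul, abs_of_nonneg (mul_nonneg (Nat.cast_nonneg _) (ha _)), ← hp', pow_add]
        rcases Nat.eq_zero_or_pos p.1 with h0 | h0
        · simp [h0]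
        · have := mul_le_mul_of_nonneg_left (ih p.2 (by omega))
            (mul_nonneg (mul_nonneg (Nat.cast_nonneg p.1) (ha p.1)) (pow_nonneg hs.le p.1))
          calc _ = _ := by ring
            _ ≤ _ := this
      have h3 : ∑ p ∈ antidiagonal n, (p.1 * a p.1 * s ^ p.1) = B := by
        rw [Finset.Nat.sum_antidiagonal_eq_sum_range_succ_mk, hB]
        symm
        refine Finset.sum_subset (Finset.range_mono (by omega)) fun k _ hk => ?_
        rw [Finset.mem_range, not_lt] at hk
        simp [hK k (by omega)]
      rw [← Finset.sum_mul, h3] at h1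
      have h4 : B ≤ n := hN.trans (by exact_mod_cast (by omega : N ≤ n))
      exact le_of_mul_le_mul_left (h1.trans (mul_le_mul_of_nonneg_right h4 hM0)) hn

theorem expNeg_summable {a : ℕ → ℝ} (ha : ∀ k, 0 ≤ a k) {K : ℕ} (hK : ∀ k, K < k → a k = 0)
    {s : ℝ} (hs : 0 < s) : Summable fun n => |expNeg a n| * s ^ n := by
  obtain ⟨M, hM⟩ := expNeg_bounded ha hK (s := 2 * s) (by positivity)
  refine Summable.of_nonneg_of_le (fun n => by positivity) (fun n => ?_)
    ((summable_geometric_of_lt_one (r := (1 / 2 : ℝ)) (by norm_num) (by norm_num)).mul_left M)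
  calc |expNeg a n| * s ^ n = |expNeg a n| * (2 * s) ^ n * (1 / 2) ^ n := by
        rw [mul_assoc, ← mul_pow]
        congr 2
        ring
    _ ≤ _ := mul_le_mul_of_nonneg_right (hM n) (by positivity)

/-- The Euler derivation of power series. -/
noncomputable def euler (f : PowerSeries ℝ) : PowerSeries ℝ :=
  PowerSeries.mk fun n => n * PowerSeries.coeff n f

theorem euler_mul (f g : PowerSeries ℝ) : euler (f * g) = euler f * g + f * euler g := by
  ext n
  simp only [euler, PowerSeries.coeff_mk, PowerSeries.coeff_mul, map_add, Finset.mul_sum]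
  rw [← Finset.sum_add_distrib]
  refine Finset.sum_congr rfl fun p hp => ?_
  rw [← mem_antidiagonal.1 hp]
  push_cast
  ring

/-- The coefficients of `B exp (-A)`, where `A` is the part of `C` up to degree `K`: the normalized
numbers of members all of whose components have more than `K` vertices. -/
noncomputable def largeParts (b c : ℕ → ℝ) (K n : ℕ) : ℝ :=
  ∑ p ∈ antidiagonal n, expNeg (fun k => if k ≤ K then c k else 0) p.1 * b p.2

theorem largeParts_rec (H : SmoothPair b c γ) (K n : ℕ) : n * largeParts b c K n =
    ∑ p ∈ antidiagonal n, p.1 * (if p.1 ≤ K then 0 else c p.1) * largeParts b c K p.2 := by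
  set a : ℕ → ℝ := fun k => if k ≤ K then c k else 0 with ha
  set E := PowerSeries.mk (expNeg a) with hE
  set F := PowerSeries.mk b with hF
  have hD : E * F = PowerSeries.mk (largeParts b c K) := by
    ext n
    simp [PowerSeries.coeff_mul, largeParts, hE, hF, ha]
  have h1 : euler E = -(PowerSeries.mk fun n => n * a n) * E := by
    ext n
    rw [neg_mul, map_neg, PowerSeries.coeff_mul]
    simp only [euler, hE, PowerSeries.coeff_mk]
    exact expNeg_rec a n
  have h2 : euler F = (PowerSeries.mk fun n => n * c n) * F := by
    ext n
    rw [PowerSeries.coeff_mul]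
    simp only [euler, hF, PowerSeries.coeff_mk]
    exact H.exp_formula n
  have h3 : euler (E * F) =
      (PowerSeries.mk fun n => n * (if n ≤ K then 0 else c n)) * (E * F) := by
    rw [euler_mul, h1, h2]
    have h4 : (PowerSeries.mk fun n => (n : ℝ) * (if n ≤ K then 0 else c n)) =
        (PowerSeries.mk fun n => n * c n) - PowerSeries.mk fun n => n * a n := by
      ext n
      simp only [PowerSeries.coeff_mk, map_sub, ha]
      split_ifs <;> ring
    rw [h4]
    ring
  have h5 := congrArg (PowerSeries.coeff n) h3
  rw [hD, PowerSeries.coeff_mul] at h5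
  simpa [euler] using h5

theorem largeParts_zero (H : SmoothPair b c γ) (K : ℕ) : largeParts b c K 0 = 1 := by
  simp [largeParts, expNeg, H.b_zero]

theorem largeParts_mem (H : SmoothPair b c γ) (K n : ℕ) :
    0 ≤ largeParts b c K n ∧ largeParts b c K n ≤ b n ∧
      (0 < n → n ≤ K → largeParts b c K n = 0) := by
  induction n using Nat.strong_induction_on with
  | _ n ih =>
    rcases Nat.eq_zero_or_pos n with rfl | hn
    · simp [H.largeParts_zero, H.b_zero]
    have hn' : (0 : ℝ) < n := by exact_mod_cast hn
    have hrec := H.largeParts_rec K n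
    have hlt : ∀ p ∈ antidiagonal n, p.1 ≠ 0 → p.2 < n := fun p hp h => by
      have := mem_antidiagonal.1 hp
      omega
    refine ⟨?_, ?_, ?_⟩
    · refine nonneg_of_mul_nonneg_right (hrec ▸ Finset.sum_nonneg fun p hp => ?_) hn'
      rcases eq_or_ne p.1 0 with h | h
      · simp [h]
      · refine mul_nonneg (mul_nonneg (Nat.cast_nonneg _) ?_) (ih p.2 (hlt p hp h)).1
        split_ifs
        exacts [le_rfl, H.c_nonneg _]
    · refine le_of_mul_le_mul_left ?_ hn'
      rw [hrec, H.exp_formula]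
      refine Finset.sum_le_sum fun p hp => ?_
      rcases eq_or_ne p.1 0 with h | h
      · simp [h]
      · have h1 := ih p.2 (hlt p hp h)
        split_ifs
        · rw [mul_zero, zero_mul]
          exact mul_nonneg (mul_nonneg (Nat.cast_nonneg _) (H.c_nonneg _)) (H.b_nonneg _)
        · exact mul_le_mul_of_nonneg_left h1.2.1 (mul_nonneg (Nat.cast_nonneg _) (H.c_nonneg _))
    · intro _ hnK
      have h0 : (n : ℝ) * largeParts b c K n = 0 := by
        rw [hrec]
        refine Finset.sum_eq_zero fun p hp => ?_
        have := mem_antidiagonal.1 hp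
        rw [if_pos (by omega)]
        simp
      exact (mul_eq_zero.1 h0).resolve_left hn'.ne'

/-- A graph all of whose components have more than `K` vertices is almost always connected. -/
theorem abs_sub_largeParts_le (H : SmoothPair b c γ) {K n : ℕ} (hK : 0 < K) (hn : K < n) :
    |c n - largeParts b c K n| ≤ 2 / K * b n := by
  have hn' : (0 : ℝ) < n := by exact_mod_cast (by omega : 0 < n)
  have hK' : (0 : ℝ) < K := by exact_mod_cast hK
  have h1 := H.largeParts_rec K n
  rw [sum_antidiagonal_head (K := K + 1) (by omega), Finset.sum_range_succ',
    Finset.sum_eq_zero (s := Finset.range K), zero_add] at h1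
  · rw [Nat.sub_zero, if_neg (by omega), H.largeParts_zero, mul_one] at h1
    set R := ∑ p ∈ antidiagonal n with K + 1 ≤ p.2,
      (p.1 : ℝ) * (if p.1 ≤ K then 0 else c p.1) * largeParts b c K p.2 with hR
    have hnn : ∀ p : ℕ × ℕ, 0 ≤ (p.1 : ℝ) * c p.1 * b p.2 := fun p =>
      mul_nonneg (mul_nonneg (Nat.cast_nonneg _) (H.c_nonneg _)) (H.b_nonneg _)
    have hR0 : 0 ≤ R := Finset.sum_nonneg fun p _ => by
      refine mul_nonneg (mul_nonneg (Nat.cast_nonneg _) ?_) (H.largeParts_mem K p.2).1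
      split_ifs
      exacts [le_rfl, H.c_nonneg _]
    have hR1 : R ≤ ∑ p ∈ antidiagonal n with K ≤ p.2, p.1 * c p.1 * b p.2 := by
      refine (Finset.sum_le_sum (g := fun p : ℕ × ℕ => (p.1 : ℝ) * c p.1 * b p.2)
        fun p _ => ?_).trans (Finset.sum_le_sum_of_subset_of_nonneg ?_ fun p _ _ => hnn p)
      · split_ifs
        · rw [mul_zero, zero_mul]
          exact hnn p
        · exact mul_le_mul_of_nonneg_left (H.largeParts_mem K p.2).2.1
            (mul_nonneg (Nat.cast_nonneg _) (H.c_nonneg _))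
      · intro p hp
        rw [Finset.mem_filter] at hp ⊢
        exact ⟨hp.1, by omega⟩
    have hR2 : K * R ≤ 2 * n * b n :=
      (mul_le_mul_of_nonneg_left hR1 hK'.le).trans (H.tail_le K n)
    have h2 : n * (largeParts b c K n - c n) = R := by linarith
    have h3 : 0 ≤ largeParts b c K n - c n :=
      nonneg_of_mul_nonneg_right (h2 ▸ hR0) hn'
    rw [abs_sub_comm, abs_of_nonneg h3, div_mul_eq_mul_div, le_div_iff₀ hK']
    refine le_of_mul_le_mul_left ?_ hn'
    calc n * ((largeParts b c K n - c n) * K) = K * R := by rw [← h2]; ring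
      _ ≤ 2 * n * b n := hR2
      _ = _ := by ring
  · intro j hj
    rw [Finset.mem_range] at hj
    simp only
    rw [(H.largeParts_mem K (j + 1)).2.2 (by omega) (by omega), mul_zero]

theorem largeParts_tendsto (H : SmoothPair b c γ) (K : ℕ) :
    ∃ l, Tendsto (fun n => largeParts b c K n / b n) atTop (𝓝 l) := by
  set a : ℕ → ℝ := fun k => if k ≤ K then c k else 0 with ha
  obtain ⟨B, r, hr, hB, hbd⟩ := H.exists_bound
  have hsum := expNeg_summable (a := a) (K := K)
    (fun k => by simp only [ha]; split_ifs; exacts [H.c_nonneg k, le_rfl])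
    (fun k hk => if_neg (by omega)) hr
  have key := tendsto_tsum_of_dominated_convergence (𝓕 := atTop)
    (f := fun n j => if j ≤ n then expNeg a j * (b (n - j) / b n) else 0)
    (g := fun j => expNeg a j * (γ⁻¹) ^ j) (bound := fun j => B * (|expNeg a j| * r ^ j))
    (hsum.mul_left B) ?_ ?_
  · refine ⟨_, key.congr fun n => ?_⟩
    rw [tsum_eq_sum (s := Finset.range (n + 1))]
    · rw [largeParts, Finset.Nat.sum_antidiagonal_eq_sum_range_succ_mk, Finset.sum_div]
      refine Finset.sum_congr rfl fun j hj => ?_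
      rw [if_pos (by simpa [Nat.lt_succ_iff] using hj), mul_div_assoc]
    · intro j hj
      rw [if_neg (by simpa [Nat.lt_succ_iff] using hj)]
  · intro j
    refine ((H.ratio_sub j).const_mul (expNeg a j)).congr' ?_
    filter_upwards [eventually_ge_atTop j] with n hn
    rw [if_pos hn]
  · filter_upwards [hbd] with n hn j
    split_ifs with hj
    · rw [norm_mul, Real.norm_eq_abs, Real.norm_eq_abs,
        abs_of_nonneg (div_nonneg (H.b_nonneg _) (H.b_nonneg _))]
      calc _ ≤ |expNeg a j| * (B * r ^ j) :=
            mul_le_mul_of_nonneg_left (hn j hj) (abs_nonneg _)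
        _ = _ := by ring
    · rw [norm_zero]
      positivity

theorem connected_tendsto (H : SmoothPair b c γ) :
    ∃ p, Tendsto (fun n => c n / b n) atTop (𝓝 p) := by
  refine exists_tendsto_of_approx fun ε hε => ?_
  obtain ⟨K, hK⟩ := exists_nat_gt (2 / ε)
  have hK0 : (0 : ℝ) < K := lt_trans (by positivity) hK
  obtain ⟨l, hl⟩ := H.largeParts_tendsto K
  refine ⟨_, l, hl, ?_⟩
  filter_upwards [H.b_pos, eventually_gt_atTop K] with n hb hn
  rw [← sub_div, abs_div, abs_of_pos hb, div_le_iff₀ hb]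
  refine (H.abs_sub_largeParts_le (by exact_mod_cast hK0) hn).trans
    (mul_le_mul_of_nonneg_right ?_ hb.le)
  rw [div_lt_iff₀ hε] at hK
  rw [div_le_iff₀ hK0]
  linarith

/-- In a sum over (component, rest) the terms with a rest of at least `K` vertices are negligible
for large `K`, and the other terms converge. -/
theorem head_approx (H : SmoothPair b c γ) {u s t : ℕ → ℝ} {σ : ℝ} (hs : ∀ n, 0 ≤ s n)
    (hsc : ∀ n, s n ≤ c n) (ht : ∀ n, 0 ≤ t n) (htb : ∀ n, t n ≤ b n)
    (hσ : Tendsto (fun n => s n / b n) atTop (𝓝 σ))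
    (hu : ∀ n : ℕ, n * u n = ∑ p ∈ antidiagonal n, p.1 * s p.1 * t p.2) {K : ℕ}
    (hK : 0 < K) :
    ∃ y : ℕ → ℝ, Tendsto y atTop (𝓝 (∑ j ∈ Finset.range K, σ * (γ⁻¹) ^ j * t j)) ∧
      ∀ᶠ n in atTop, |u n / b n - y n| ≤ 2 / K := by
  refine ⟨fun n => ∑ j ∈ Finset.range K, ((n - j : ℕ) / n : ℝ) *
    (s (n - j) / b (n - j) * (b (n - j) / b n)) * t j, ?_, ?_⟩
  · refine tendsto_finsetSum _ fun j _ => ?_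
    have h1 : Tendsto (fun n : ℕ => ((n - j : ℕ) / n : ℝ)) atTop (𝓝 1) := by
      have h2 : Tendsto (fun n : ℕ => 1 - (j : ℝ) / n) atTop (𝓝 (1 - 0)) :=
        tendsto_const_nhds.sub (tendsto_const_div_atTop_nhds_zero_nat (j : ℝ))
      rw [sub_zero] at h2
      refine h2.congr' ?_
      filter_upwards [eventually_ge_atTop j, eventually_gt_atTop 0] with n hn hn0
      have : (n : ℝ) ≠ 0 := by exact_mod_cast hn0.ne'
      rw [Nat.cast_sub hn, sub_div, div_self this]
    have h2 : Tendsto (fun n => s (n - j) / b (n - j)) atTop (𝓝 σ) :=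
      hσ.comp (tendsto_sub_atTop_nat j)
    have h3 := (h1.mul (h2.mul (H.ratio_sub j))).mul_const (t j)
    rwa [one_mul] at h3
  · have hall : ∀ᶠ n in atTop, ∀ j ∈ Finset.range K, b (n - j) ≠ 0 := by
      rw [Filter.eventually_all_finset]
      exact fun j _ => (tendsto_sub_atTop_nat j).eventually H.b_ne_zero
    filter_upwards [H.b_pos, eventually_ge_atTop K, hall] with n hb hn hall
    have hn0 : (0 : ℝ) < n := by exact_mod_cast (by omega : 0 < n)
    have hK' : (0 : ℝ) < K := by exact_mod_cast hK
    have h1 := hu n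
    rw [sum_antidiagonal_head hn] at h1
    set R := ∑ p ∈ antidiagonal n with K ≤ p.2, (p.1 : ℝ) * s p.1 * t p.2 with hR
    have hR0 : 0 ≤ R := Finset.sum_nonneg fun p _ =>
      mul_nonneg (mul_nonneg (Nat.cast_nonneg _) (hs _)) (ht _)
    have hR1 : R ≤ ∑ p ∈ antidiagonal n with K ≤ p.2, p.1 * c p.1 * b p.2 :=
      Finset.sum_le_sum fun p _ => mul_le_mul
        (mul_le_mul_of_nonneg_left (hsc _) (Nat.cast_nonneg _)) (htb _) (ht _)
        (mul_nonneg (Nat.cast_nonneg _) (H.c_nonneg _))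
    have hR2 : K * R ≤ 2 * n * b n :=
      (mul_le_mul_of_nonneg_left hR1 hK'.le).trans (H.tail_le K n)
    have h2 : u n / b n - ∑ j ∈ Finset.range K, ((n - j : ℕ) / n : ℝ) *
        (s (n - j) / b (n - j) * (b (n - j) / b n)) * t j = R / (n * b n) := by
      have h3 : ∑ j ∈ Finset.range K, ((n - j : ℕ) / n : ℝ) *
          (s (n - j) / b (n - j) * (b (n - j) / b n)) * t j =
          (∑ j ∈ Finset.range K, ((n - j : ℕ) : ℝ) * s (n - j) * t j) / (n * b n) := by
        rw [Finset.sum_div]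
        refine Finset.sum_congr rfl fun j hj => ?_
        rw [div_mul_div_cancel₀ (hall j hj)]
        field_simp
      rw [h3, ← mul_div_mul_left (u n) (b n) hn0.ne', h1, ← sub_div]
      simp
    rw [h2, abs_of_nonneg (by positivity), div_le_div_iff₀ (by positivity) hK']
    linarith

theorem exists_tendsto (H : SmoothPair b c γ) {u s t : ℕ → ℝ} {σ : ℝ} (hs : ∀ n, 0 ≤ s n)
    (hsc : ∀ n, s n ≤ c n) (ht : ∀ n, 0 ≤ t n) (htb : ∀ n, t n ≤ b n)
    (hσ : Tendsto (fun n => s n / b n) atTop (𝓝 σ))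
    (hu : ∀ n : ℕ, n * u n = ∑ p ∈ antidiagonal n, p.1 * s p.1 * t p.2) :
    ∃ l, Tendsto (fun n => u n / b n) atTop (𝓝 l) := by
  refine exists_tendsto_of_approx fun ε hε => ?_
  obtain ⟨K, hK⟩ := exists_nat_gt (2 / ε)
  have hK0 : (0 : ℝ) < K := lt_trans (by positivity) hK
  obtain ⟨y, hy, hxy⟩ := H.head_approx hs hsc ht htb hσ hu (K := K) (by exact_mod_cast hK0)
  refine ⟨y, _, hy, hxy.mono fun n hn => hn.trans ?_⟩
  rw [div_lt_iff₀ hε] at hK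
  rw [div_le_iff₀ hK0]
  linarith

theorem c_le_b (H : SmoothPair b c γ) {n : ℕ} (hn : 0 < n) : c n ≤ b n := by
  have hn' : (0 : ℝ) < n := by exact_mod_cast hn
  refine le_of_mul_le_mul_left ?_ hn'
  rw [H.exp_formula]
  have := Finset.single_le_sum (s := antidiagonal n)
    (f := fun p : ℕ × ℕ => (p.1 : ℝ) * c p.1 * b p.2) (a := (n, 0))
    (fun p _ => mul_nonneg (mul_nonneg (Nat.cast_nonneg _) (H.c_nonneg _)) (H.b_nonneg _))
    (by simp)
  simpa [H.b_zero] using this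

/-- The limit `p` of the probability of connectedness satisfies `p * ∑ j, b j * γ⁻¹ ^ j = 1`. -/
theorem limit_mem_Ioo (H : SmoothPair b c γ) {p : ℝ}
    (hp : Tendsto (fun n => c n / b n) atTop (𝓝 p)) : 0 < p ∧ p < 1 := by
  have hp0 : 0 ≤ p := ge_of_tendsto' hp fun n => div_nonneg (H.c_nonneg _) (H.b_nonneg _)
  have hγ := H.γ_pos
  have key : ∀ K : ℕ, 0 < K → |1 - ∑ j ∈ Finset.range K, p * (γ⁻¹) ^ j * b j| ≤ 2 / K := by
    intro K hK
    obtain ⟨y, hy, hxy⟩ := H.head_approx H.c_nonneg (fun _ => le_rfl) H.b_nonneg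
      (fun _ => le_rfl) hp H.exp_formula hK
    refine le_of_tendsto (tendsto_const_nhds.sub hy).abs ?_
    filter_upwards [hxy, H.b_ne_zero] with n hn hb
    rwa [div_self hb] at hn
  constructor
  · refine lt_of_le_of_ne hp0 fun h => ?_
    have := key 4 (by norm_num)
    rw [← h] at this
    norm_num at this
  · obtain ⟨h, hh, hc⟩ := H.exists_c_pos
    have hbh : 0 < b h := hc.trans_le (H.c_le_b hh)
    have hle : ∀ K : ℕ, h < K → p * (1 + (γ⁻¹) ^ h * b h) ≤ 1 + 2 / K := by
      intro K hK
      have h1 := abs_le.1 (key K (by omega))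
      have h2 : ∑ j ∈ {0, h}, p * (γ⁻¹) ^ j * b j ≤
          ∑ j ∈ Finset.range K, p * (γ⁻¹) ^ j * b j := by
        refine Finset.sum_le_sum_of_subset_of_nonneg ?_ fun j _ _ =>
          mul_nonneg (by positivity) (H.b_nonneg j)
        intro j hj
        simp only [Finset.mem_insert, Finset.mem_singleton] at hj
        rw [Finset.mem_range]
        omega
      rw [Finset.sum_pair hh.ne, H.b_zero] at h2
      linarith
    have hlim : Tendsto (fun K : ℕ => 1 + (2 : ℝ) / K) atTop (𝓝 (1 + 0)) :=
      tendsto_const_nhds.add (tendsto_const_div_atTop_nhds_zero_nat 2)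
    have h3 := ge_of_tendsto hlim ((eventually_gt_atTop h).mono hle)
    have h4 : 0 < (γ⁻¹) ^ h * b h := by positivity
    nlinarith

end SmoothPair

/-! ### Counting graphs by the component of a vertex -/

/-- A set of vertices without edges to its complement is closed under reachability. -/
theorem SimpleGraph.Reachable.mem_of_noCross {V : Type} {G : SimpleGraph V} {S : Set V}
    (h : ∀ x ∈ S, ∀ y ∉ S, ¬ G.Adj x y) {x y : V} (hx : x ∈ S) (hxy : G.Reachable x y) : y ∈ S := by
  obtain ⟨⟨z, hz⟩, rfl, -⟩ := SimpleGraph.Reachable.exists_of_closed_range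
    (f := SimpleGraph.Embedding.induce S) (x := ⟨x, hx⟩) (y := y)
    (fun x _ hxy => ⟨⟨_, by_contra fun hy => h x.1 x.2 _ hy hxy⟩, rfl⟩) hxy
  exact hz

namespace GraphClass

variable {V : Type}

theorem card_mem (C : GraphClass) (V : Type) [Finite V] :
    Nat.card {G : SimpleGraph V // C.Mem G} = C.count (Nat.card V) := by
  let e := Finite.equivFin V
  refine (Nat.card_congr (Equiv.subtypeEquiv e.simpleGraph fun G => ?_)).trans
    (Nat.card_coe_set_eq _)
  exact C.mem_iso (SimpleGraph.Iso.comap e.symm G).symm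

/-- The graph consisting of a graph on `S` and a graph on the complement of `S`. -/
noncomputable def glue (S : Set V) (G : SimpleGraph S) (H : SimpleGraph (Sᶜ : Set V)) :
    SimpleGraph V :=
  haveI := Classical.decPred (· ∈ S)
  (G ⊕g H).comap (Equiv.Set.sumCompl S).symm

theorem glue_induce (S : Set V) (G : SimpleGraph S) (H : SimpleGraph (Sᶜ : Set V)) :
    (glue S G H).induce S = G := by
  ext x y
  simp [glue]

theorem glue_induce_compl (S : Set V) (G : SimpleGraph S) (H : SimpleGraph (Sᶜ : Set V)) :
    (glue S G H).induce Sᶜ = H := by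
  ext x y
  simp [glue]

theorem glue_noCross (S : Set V) (G : SimpleGraph S) (H : SimpleGraph (Sᶜ : Set V)) :
    ∀ x ∈ S, ∀ y ∉ S, ¬ (glue S G H).Adj x y := by
  classical
  intro x hx y hy
  simp [glue, Equiv.Set.sumCompl_symm_apply_of_mem hx, Equiv.Set.sumCompl_symm_apply_of_notMem hy]

theorem glue_of_noCross {S : Set V} {G : SimpleGraph V} (h : ∀ x ∈ S, ∀ y ∉ S, ¬ G.Adj x y) :
    glue S (G.induce S) (G.induce Sᶜ) = G := by
  classical
  ext x y
  by_cases hx : x ∈ S <;> by_cases hy : y ∈ S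
  · simp [glue, Equiv.Set.sumCompl_symm_apply_of_mem hx, Equiv.Set.sumCompl_symm_apply_of_mem hy]
  · exact iff_of_false (glue_noCross S _ _ x hx y hy) (h x hx y hy)
  · exact iff_of_false (fun h' => glue_noCross S _ _ y hy x hx h'.symm)
      fun h' => h y hy x hx h'.symm
  · simp [glue, Equiv.Set.sumCompl_symm_apply_of_notMem hx,
      Equiv.Set.sumCompl_symm_apply_of_notMem hy]

/-- The vertex set of the component of `v`. -/
def comp (G : SimpleGraph V) (v : V) : Set V := (G.connectedComponentMk v).supp

theorem mem_comp {G : SimpleGraph V} {u v : V} : u ∈ comp G v ↔ G.Reachable u v :=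
  SimpleGraph.ConnectedComponent.eq

theorem comp_noCross (G : SimpleGraph V) (v : V) :
    ∀ x ∈ comp G v, ∀ y ∉ comp G v, ¬ G.Adj x y := fun _ hx _ hy h =>
  hy (mem_comp.2 (h.symm.reachable.trans (mem_comp.1 hx)))

theorem comp_connected (G : SimpleGraph V) (v : V) : (G.induce (comp G v)).Connected :=
  (G.connectedComponentMk v).connected_toSimpleGraph

theorem comp_eq {G : SimpleGraph V} {S : Set V} {v : V} (hv : v ∈ S)
    (h : ∀ x ∈ S, ∀ y ∉ S, ¬ G.Adj x y) (hS : (G.induce S).Connected) : comp G v = S := by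
  ext u
  rw [mem_comp]
  constructor
  · intro hu
    exact hu.symm.mem_of_noCross h hv
  · intro hu
    exact (hS.preconnected ⟨u, hu⟩ ⟨v, hv⟩).map (SimpleGraph.Embedding.induce S).toHom

theorem mem_induce_congr (C : GraphClass) [Finite V] (G : SimpleGraph V) {S T : Set V}
    (h : S = T) : C.Mem (G.induce S) ↔ C.Mem (G.induce T) := by
  subst h
  rfl

/-- The pairs of a graph and a vertex whose component lies in the class `A`, and the rest of the
graph in the class `B`. -/
abbrev Pointed (A B : GraphClass) (V : Type) [Finite V] : Type :=
  {p : SimpleGraph V × V // A.Mem (p.1.induce (comp p.1 p.2)) ∧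
    B.Mem (p.1.induce (comp p.1 p.2)ᶜ)}

theorem card_pointed_fiber {A B : GraphClass}
    (hA : ∀ {V : Type} [Finite V] (G : SimpleGraph V), A.Mem G → G.Connected)
    [Finite V] (S : Set V) :
    Nat.card {p : Pointed A B V // comp p.1.1 p.1.2 = S} =
      S.ncard * (A.count S.ncard * B.count (Sᶜ).ncard) := by
  rw [← Nat.card_coe_set_eq S, ← Nat.card_coe_set_eq Sᶜ, ← A.card_mem, ← B.card_mem,
    ← Nat.card_prod, ← Nat.card_prod]
  refine Nat.card_congr
    { toFun := fun p => ⟨⟨p.1.1.2, p.2.subset (mem_comp.2 (SimpleGraph.Reachable.refl _))⟩,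
        ⟨p.1.1.1.induce S, by obtain ⟨⟨p, h, -⟩, rfl⟩ := p; exact h⟩,
        ⟨p.1.1.1.induce Sᶜ, by obtain ⟨⟨p, -, h⟩, rfl⟩ := p; exact h⟩⟩
      invFun := fun x =>
        have hc : comp (glue S x.2.1.1 x.2.2.1) x.1.1 = S :=
          comp_eq x.1.2 (glue_noCross _ _ _) ((glue_induce S _ _).symm ▸ hA _ x.2.1.2)
        ⟨⟨(glue S x.2.1.1 x.2.2.1, x.1.1), by
          refine ⟨(A.mem_induce_congr _ hc).2 ?_, (B.mem_induce_congr _ (congrArg _ hc)).2 ?_⟩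
          · rw [glue_induce]
            exact x.2.1.2
          · rw [glue_induce_compl]
            exact x.2.2.2⟩, hc⟩
      left_inv := ?_
      right_inv := ?_ }
  · rintro ⟨⟨⟨G, v⟩, h⟩, rfl⟩
    refine Subtype.ext (Subtype.ext (Prod.ext ?_ rfl))
    exact glue_of_noCross (comp_noCross G v)
  · rintro ⟨v, ⟨G, hG⟩, ⟨H, hH⟩⟩
    refine Prod.ext rfl (Prod.ext (Subtype.ext ?_) (Subtype.ext ?_))
    · exact glue_induce S G H
    · exact glue_induce_compl S G H

theorem sum_pointed {A B : GraphClass}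
    (hA : ∀ {V : Type} [Finite V] (G : SimpleGraph V), A.Mem G → G.Connected)
    (n : ℕ) (w : ℕ → ℕ) [Fintype (Pointed A B (Fin n))] :
    ∑ p : Pointed A B (Fin n), w (comp p.1.1 p.1.2).ncard =
      ∑ p ∈ antidiagonal n, n.choose p.1 * (p.1 * (A.count p.1 * B.count p.2) * w p.1) := by
  classical
  have h1 : ∀ S : Finset (Fin n),
      ∑ p : Pointed A B (Fin n) with (comp p.1.1 p.1.2).toFinset = S,
        w (comp p.1.1 p.1.2).ncard =
      S.card * (A.count S.card * B.count (n - S.card)) * w S.card := by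
    intro S
    have h2 : ((Finset.univ : Finset (Pointed A B (Fin n))).filter
        fun p => (comp p.1.1 p.1.2).toFinset = S).card =
        S.card * (A.count S.card * B.count (n - S.card)) := by
      have h3 := card_pointed_fiber (B := B) hA (S : Set (Fin n))
      rw [Set.ncard_coe_finset, ← Finset.coe_compl, Set.ncard_coe_finset, Finset.card_compl,
        Fintype.card_fin] at h3
      rw [← h3, Nat.card_eq_fintype_card, Fintype.card_subtype]
      congr 1
      refine Finset.filter_congr fun p _ => ?_
      rw [← Finset.coe_inj, Set.coe_toFinset]
    rw [← h2, ← smul_eq_mul, ← Finset.sum_const]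
    refine Finset.sum_congr rfl fun p hp => ?_
    rw [Finset.mem_filter] at hp
    rw [← hp.2, Set.ncard_eq_toFinset_card']
  rw [← Finset.sum_fiberwise (Finset.univ) fun p : Pointed A B (Fin n) =>
    (comp p.1.1 p.1.2).toFinset, Finset.sum_congr rfl fun S _ => h1 S, ← Finset.powerset_univ,
    Finset.sum_powerset_apply_card fun k => k * (A.count k * B.count (n - k)) * w k,
    Finset.card_univ, Fintype.card_fin, Finset.Nat.sum_antidiagonal_eq_sum_range_succ_mk]
  simp only [smul_eq_mul]

theorem card_pointed {A B : GraphClass}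
    (hA : ∀ {V : Type} [Finite V] (G : SimpleGraph V), A.Mem G → G.Connected) (n : ℕ) :
    Nat.card (Pointed A B (Fin n)) =
      ∑ p ∈ antidiagonal n, n.choose p.1 * (p.1 * (A.count p.1 * B.count p.2)) := by
  have := Fintype.ofFinite (Pointed A B (Fin n))
  have h := sum_pointed (B := B) hA n fun _ => 1
  simpa [Nat.card_eq_fintype_card] using h

/-! ### Bridges -/

theorem _root_.SimpleGraph.IsAcyclic.card_adj_le [Fintype V] {F : SimpleGraph V}
    (hF : F.IsAcyclic) : Nat.card {p : V × V // F.Adj p.1 p.2} ≤ 2 * Fintype.card V := by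
  classical
  rcases isEmpty_or_nonempty V with h | h
  · simp
  obtain ⟨T, hT, -, hT'⟩ := SimpleGraph.connected_top.exists_isTree_le_of_le_of_isAcyclic
    (le_top : F ≤ ⊤) hF
  have h1 := hT'.card_edgeFinset
  have h2 := T.two_mul_card_edgeFinset
  have h3 : Nat.card {p : V × V // F.Adj p.1 p.2} ≤ Nat.card {p : V × V // T.Adj p.1 p.2} :=
    Nat.card_le_card_of_injective (Subtype.map id fun p h => hT h)
      (Subtype.map_injective _ Function.injective_id)
  have h4 : Nat.card {p : V × V // T.Adj p.1 p.2} = 2 * T.edgeFinset.card := by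
    rw [h2, Nat.card_eq_fintype_card, Fintype.card_subtype]
  omega

/-- The bridges form an acyclic graph. -/
theorem card_bridges_le [Fintype V] (G : SimpleGraph V) :
    Nat.card {p : V × V // G.Adj p.1 p.2 ∧ G.IsBridge s(p.1, p.2)} ≤ 2 * Fintype.card V := by
  let F : SimpleGraph V :=
    { Adj := fun x y => G.Adj x y ∧ G.IsBridge s(x, y)
      symm := ⟨fun x y h => ⟨h.1.symm, Sym2.eq_swap ▸ h.2⟩⟩
      loopless := ⟨fun x h => G.loopless.irrefl x h.1⟩ }
  have hF : F.IsAcyclic := by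
    rw [SimpleGraph.isAcyclic_iff_forall_adj_isBridge]
    exact fun x y h => SimpleGraph.IsBridge.anti (fun _ _ h => h.1) h.2
  exact hF.card_adj_le

/-- Adding an edge between distinct components creates a bridge, from which the original graph can
be recovered; and a graph has few bridges. -/
theorem BridgeAddable.card_le {C : GraphClass} (hC : C.BridgeAddable) (n : ℕ) :
    Nat.card {p : SimpleGraph (Fin n) × (Fin n × Fin n) //
      C.Mem p.1 ∧ ¬ p.1.Reachable p.2.1 p.2.2} ≤ C.count n * (2 * n) := by
  have h1 : Nat.card {p : SimpleGraph (Fin n) × (Fin n × Fin n) //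
      C.Mem p.1 ∧ ¬ p.1.Reachable p.2.1 p.2.2} ≤
      Nat.card (Σ G : {G : SimpleGraph (Fin n) // C.Mem G},
        {p : Fin n × Fin n // G.1.Adj p.1 p.2 ∧ G.1.IsBridge s(p.1, p.2)}) := by
    refine Nat.card_le_card_of_injective (fun p =>
      ⟨⟨p.1.1 ⊔ SimpleGraph.edge p.1.2.1 p.1.2.2, hC _ _ p.2.1 _ _ fun h =>
        p.2.2 (SimpleGraph.ConnectedComponent.exact h)⟩, p.1.2, ?_, ?_⟩) ?_
    · refine Or.inr ((SimpleGraph.edge_adj _ _ _ _).2 ⟨Or.inl ⟨rfl, rfl⟩, fun h => p.2.2 ?_⟩)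
      rw [h]
    · exact SimpleGraph.isBridge_sup_edge.2 (SimpleGraph.IsBridge.of_not_reachable p.2.2)
    · rintro ⟨⟨G, u, v⟩, hG, huv⟩ ⟨⟨G', u', v'⟩, hG', huv'⟩ h
      have h1 : G ⊔ SimpleGraph.edge u v = G' ⊔ SimpleGraph.edge u' v' :=
        congrArg (fun x => x.1.1) h
      have h3 : (u, v) = (u', v') := congrArg (fun x => x.2.1) h
      obtain ⟨rfl, rfl⟩ := Prod.mk.inj h3
      refine Subtype.ext (Prod.ext ?_ rfl)
      have hdel : ∀ H : SimpleGraph (Fin n), ¬ H.Reachable u v →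
          (H ⊔ SimpleGraph.edge u v).deleteEdges {s(u, v)} = H := by
        intro H hH
        ext x y
        have hne : H.Adj x y → ¬ (s(x, y) = s(u, v)) := by
          intro hxy he
          rcases Sym2.eq_iff.1 he with ⟨rfl, rfl⟩ | ⟨rfl, rfl⟩
          · exact hH hxy.reachable
          · exact hH hxy.symm.reachable
        simp only [SimpleGraph.deleteEdges_adj, SimpleGraph.sup_adj, SimpleGraph.edge_adj,
          Set.mem_singleton_iff]
        constructor
        · rintro ⟨h | ⟨h, -⟩, h'⟩
          · exact h
          · exact absurd (Sym2.eq_iff.2 h) h'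
        · exact fun h => ⟨Or.inl h, hne h⟩
      change G = G'
      rw [← hdel G huv, ← hdel G' huv', h1]
  refine h1.trans ?_
  have := Fintype.ofFinite {G : SimpleGraph (Fin n) // C.Mem G}
  rw [Nat.card_sigma]
  refine (Finset.sum_le_sum fun G _ => card_bridges_le G.1).trans ?_
  rw [Finset.sum_const, Finset.card_univ, ← Nat.card_eq_fintype_card, C.card_mem, Nat.card_fin,
    Fintype.card_fin, smul_eq_mul]

/-- The connected members of a class. -/
def connectedPart (C : GraphClass) : GraphClass where
  Mem G := C.Mem G ∧ G.Connected
  iso_closed G H e h := ⟨C.iso_closed G H e h.1, (SimpleGraph.Iso.connected_iff e.some).1 h.2⟩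

/-- The members of a class with a given monadic second-order type. -/
def ofType (C : GraphClass) (q : ℕ) (t : MSOType q Empty) : GraphClass where
  Mem G := C.Mem G ∧ MSOType.ofGraph q G = t
  iso_closed G H e h := ⟨C.iso_closed G H e h.1, (MSOType.ofGraph_iso q e.some).trans h.2⟩

theorem connectedPart_connected {C : GraphClass} {V : Type} [Finite V] (G : SimpleGraph V)
    (h : C.connectedPart.Mem G) : G.Connected := h.2

theorem Decomposable.mem_iff_comp {C : GraphClass} (hC : C.Decomposable) [Finite V]
    (G : SimpleGraph V) (v : V) : C.connectedPart.Mem (G.induce (comp G v)) ∧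
      C.Mem (G.induce (comp G v)ᶜ) ↔ C.Mem G := by
  rw [hC.mem_of_noCross (comp_noCross G v)]
  exact and_congr_left fun _ => and_iff_left (comp_connected G v)

theorem Decomposable.count_mul {C : GraphClass} (hC : C.Decomposable) (n : ℕ) :
    n * C.count n = ∑ p ∈ antidiagonal n,
      n.choose p.1 * (p.1 * (C.connectedPart.count p.1 * C.count p.2)) := by
  have h0 : Nat.card (Pointed C.connectedPart C (Fin n)) =
      Nat.card {p : SimpleGraph (Fin n) × Fin n // C.Mem p.1} :=
    Nat.card_congr (Equiv.subtypeEquivRight fun p => hC.mem_iff_comp p.1 p.2)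
  rw [← card_pointed connectedPart_connected, h0, mul_comm]
  have h := C.card_mem (Fin n)
  rw [Nat.card_fin] at h
  conv_lhs => rw [← h, ← Nat.card_fin n, ← Nat.card_prod]
  rw [Nat.card_fin]
  exact Nat.card_congr
    { toFun := fun x => ⟨(x.1.1, x.2), x.1.2⟩
      invFun := fun x => ⟨⟨x.1.1, x.2⟩, x.1.2⟩
      left_inv := fun _ => rfl
      right_inv := fun _ => rfl }

theorem Addable.tail_le {C : GraphClass} (hC : C.Addable) (K n : ℕ) :
    K * ∑ p ∈ antidiagonal n with K ≤ p.2,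
      n.choose p.1 * (p.1 * (C.connectedPart.count p.1 * C.count p.2)) ≤ C.count n * (2 * n) := by
  classical
  have := Fintype.ofFinite (Pointed C.connectedPart C (Fin n))
  refine le_trans ?_ (hC.2.card_le n)
  have h1 : Nat.card {p : SimpleGraph (Fin n) × (Fin n × Fin n) //
      C.Mem p.1 ∧ ¬ p.1.Reachable p.2.1 p.2.2} =
      Nat.card (Σ p : Pointed C.connectedPart C (Fin n), ((comp p.1.1 p.1.2)ᶜ : Set (Fin n))) :=
    Nat.card_congr
      { toFun := fun x => ⟨⟨(x.1.1, x.1.2.1), (hC.1.mem_iff_comp _ _).2 x.2.1⟩,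
          ⟨x.1.2.2, fun h => x.2.2 (mem_comp.1 h).symm⟩⟩
        invFun := fun x => ⟨(x.1.1.1, (x.1.1.2, x.2.1)), (hC.1.mem_iff_comp _ _).1 x.1.2,
          fun h => x.2.2 (mem_comp.2 h.symm)⟩
        left_inv := fun _ => rfl
        right_inv := fun _ => rfl }
  have h2 := sum_pointed (A := C.connectedPart) (B := C) connectedPart_connected n fun k => n - k
  rw [h1, Nat.card_sigma]
  have h3 : ∀ p : Pointed C.connectedPart C (Fin n),
      Nat.card ((comp p.1.1 p.1.2)ᶜ : Set (Fin n)) = n - (comp p.1.1 p.1.2).ncard := by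
    intro p
    rw [Nat.card_coe_set_eq, Set.ncard_compl, Nat.card_fin]
  rw [Finset.sum_congr rfl fun p _ => h3 p, h2, Finset.mul_sum]
  refine (Finset.sum_le_sum fun p hp => ?_).trans
    (Finset.sum_le_sum_of_subset (Finset.filter_subset _ _))
  rw [Finset.mem_filter, mem_antidiagonal] at hp
  have : K ≤ n - p.1 := by omega
  calc _ = n.choose p.1 * (p.1 * (C.connectedPart.count p.1 * C.count p.2) * K) := by ring
    _ ≤ _ := by gcongr

end GraphClass

/-! ### Pendant copies of a rooted graph -/

namespace RootedGraph

variable {V : Type}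

/-- The graph `G` arises by attaching `P` to some rooted graph. -/
def IsPendantIn (P : RootedGraph) (G : SimpleGraph V) : Prop :=
  ∃ F : RootedGraph, Nonempty ((F.attach P).G ≃g G)

theorem IsPendantIn.iso {W : Type} {P : RootedGraph} {G : SimpleGraph V} {H : SimpleGraph W}
    (e : G ≃g H) (h : P.IsPendantIn G) : P.IsPendantIn H := by
  obtain ⟨F, ⟨f⟩⟩ := h
  exact ⟨F, ⟨f.trans e⟩⟩

/-- The set `W` induces a copy of `P` with root `s` in `X`, and the edge from `u` to `s` is the only
edge between `W` and its complement. -/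
structure PendantAt (P : RootedGraph) (X : SimpleGraph V) (W : Set V) (u s : V) : Prop where
  notMem : u ∉ W
  mem : s ∈ W
  adj_iff : ∀ x ∉ W, ∀ y ∈ W, X.Adj x y ↔ x = u ∧ y = s
  exists_iso : ∃ φ : X.induce W ≃g P.G, φ ⟨s, mem⟩ = P.root

namespace PendantAt

variable {P : RootedGraph} {X : SimpleGraph V} {W W' : Set V} {u s u' s' : V}

theorem isPendantIn [Finite V] (h : P.PendantAt X W u s) : P.IsPendantIn X := by
  classical
  obtain ⟨φ, hφ⟩ := h.exists_iso
  have hs : ∀ p, (φ.symm p : V) = s ↔ p = P.root := by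
    intro p
    rw [← hφ]
    constructor
    · intro hp
      rw [← φ.apply_symm_apply p]
      exact congrArg φ (Subtype.ext hp)
    · rintro rfl
      simp
  refine ⟨⟨(Wᶜ : Set V), X.induce Wᶜ, ⟨u, h.notMem⟩⟩,
    ⟨⟨((Equiv.sumComm _ _).trans (Equiv.sumCongr φ.symm.toEquiv (Equiv.refl _))).trans
      (Equiv.Set.sumCompl W), ?_⟩⟩⟩
  have h1 : ∀ (x : (Wᶜ : Set V)) (p : P.V), X.Adj x (φ.symm p) ↔ x = ⟨u, h.notMem⟩ ∧ p = P.root :=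
    fun x p => by rw [h.adj_iff x x.2 _ (φ.symm p).2, hs, Subtype.ext_iff]
  rintro (x | p) (y | p')
  · refine Iff.trans ?_ attach_adj_inl_inl.symm
    exact Iff.rfl
  · exact (h1 x p').trans attach_adj_inl_inr.symm
  · exact (X.adj_comm _ _).trans ((h1 y p).trans attach_adj_inr_inl.symm)
  · exact (φ.symm.map_rel_iff (a := p) (b := p')).trans attach_adj_inr_inr.symm

theorem connected (h : P.PendantAt X W u s) (hP : P.G.Connected) : (X.induce W).Connected :=
  h.exists_iso.choose.connected_iff.2 hP

/-- A connected set that leaves `W` contains the only vertex outside `W` with a neighbour in `W`. -/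
theorem mem_of_meets (h : P.PendantAt X W u s) {T : Set V} (hT : (X.induce T).Connected) {x y : V}
    (hx : x ∈ T) (hxW : x ∈ W) (hy : y ∈ T) (hyW : y ∉ W) : u ∈ T := by
  by_contra hu
  refine hyW (SimpleGraph.Reachable.mem_of_noCross (S := {z : T | z.1 ∈ W}) ?_
    (show (⟨x, hx⟩ : T) ∈ _ from hxW) (hT.preconnected ⟨x, hx⟩ ⟨y, hy⟩))
  intro a ha b hb hab
  exact hu (((h.adj_iff b.1 hb a.1 ha).1 hab.symm).1 ▸ b.2)

/-- Two pendant copies on less than all vertices cannot contain the attachment vertices of each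
other: their union would have no edges to its complement. -/
theorem not_mutually_attached [Finite V] (hX : X.Connected) (hcard : W.ncard + W'.ncard < Nat.card V)
    (h : P.PendantAt X W u s) (h' : P.PendantAt X W' u' s') (hu : u ∈ W') (hu' : u' ∈ W) :
    False := by
  have hne : W ∪ W' ≠ Set.univ := by
    intro he
    have h1 := Set.ncard_union_le W W'
    rw [he, Set.ncard_univ] at h1
    omega
  obtain ⟨z, hz⟩ := (Set.ne_univ_iff_exists_notMem _).1 hne
  refine hz (SimpleGraph.Reachable.mem_of_noCross ?_ (Or.inl h.mem : s ∈ W ∪ W')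
    (hX.preconnected s z))
  rintro a (ha | ha) b hb hab
  · have := (h.adj_iff b (fun hb' => hb (Or.inl hb')) a ha).1 hab.symm
    exact hb (Or.inr (this.1 ▸ hu))
  · have := (h'.adj_iff b (fun hb' => hb (Or.inr hb')) a ha).1 hab.symm
    exact hb (Or.inl (this.1 ▸ hu'))

theorem isPendantIn_compl [Finite V] (h' : P.PendantAt X W' u' s') (hd : Disjoint W W')
    (hu' : u' ∉ W) : P.IsPendantIn (X.induce Wᶜ) := by
  have hsub : ∀ z ∈ W', z ∈ Wᶜ := fun z hz hz' => Set.disjoint_left.1 hd hz' hz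
  obtain ⟨φ, hφ⟩ := h'.exists_iso
  let ψ : (X.induce Wᶜ).induce {z : (Wᶜ : Set V) | z.1 ∈ W'} ≃g X.induce W' :=
    { toFun := fun z => ⟨z.1.1, z.2⟩
      invFun := fun z => ⟨⟨z.1, hsub z.1 z.2⟩, z.2⟩
      left_inv := fun _ => rfl
      right_inv := fun _ => rfl
      map_rel_iff' := Iff.rfl }
  have key : P.PendantAt (X.induce Wᶜ) {z : (Wᶜ : Set V) | z.1 ∈ W'} ⟨u', hu'⟩
      ⟨s', hsub _ h'.mem⟩ :=
    { notMem := h'.notMem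
      mem := h'.mem
      adj_iff := fun x hx y hy => by
        rw [Subtype.ext_iff, Subtype.ext_iff]
        exact h'.adj_iff x.1 hx y.1 hy
      exists_iso := ⟨ψ.trans φ, hφ⟩ }
  exact key.isPendantIn

/-- There is at most one pendant copy of `P` whose removal destroys all pendant copies: of two
distinct copies, either one remains pendant after the removal of the other, or they contain the
attachment vertices of each other. -/
theorem unique [Finite V] (hP : P.G.Connected) (hX : X.Connected)
    (hcard : 2 * W.ncard < Nat.card V) (hWW' : W.ncard = W'.ncard)
    (h : P.PendantAt X W u s) (h' : P.PendantAt X W' u' s')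
    (hn : ¬ P.IsPendantIn (X.induce Wᶜ)) (hn' : ¬ P.IsPendantIn (X.induce W'ᶜ)) : W = W' := by
  by_contra hne
  have hc : W.ncard + W'.ncard < Nat.card V := by omega
  rcases Set.disjoint_or_nonempty_inter W W' with hd | ⟨x, hx, hx'⟩
  · exact not_mutually_attached hX hc h h' (by_contra fun hu => hn' (h.isPendantIn_compl hd.symm hu))
      (by_contra fun hu' => hn (h'.isPendantIn_compl hd hu'))
  · obtain ⟨y, hy, hyW⟩ := Set.not_subset.1 fun hsub : W' ⊆ W =>
      hne (Set.eq_of_subset_of_ncard_le hsub hWW'.le).symm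
    obtain ⟨z, hz, hzW⟩ := Set.not_subset.1 fun hsub : W ⊆ W' =>
      hne (Set.eq_of_subset_of_ncard_le hsub hWW'.ge)
    exact not_mutually_attached hX hc h h' (h.mem_of_meets (h'.connected hP) hx' hx hy hyW)
      (h'.mem_of_meets (h.connected hP) hx hx' hz hzW)

end PendantAt

/-- The graph `G` on `T` with the graph `P`, transported to the complement of `T`, attached at
`u`. -/
noncomputable def plant (P : RootedGraph) (T : Set V) (e : (Tᶜ : Set V) ≃ P.V) [Finite V]
    (G : SimpleGraph T) (u : T) : SimpleGraph V :=
  haveI := Classical.decPred (· ∈ T)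
  ((⟨T, G, u⟩ : RootedGraph).attach P).G.comap
    ((Equiv.Set.sumCompl T).symm.trans (Equiv.sumCongr (Equiv.refl _) e))

variable [Finite V] {P : RootedGraph} {T : Set V} {e : (Tᶜ : Set V) ≃ P.V} {G : SimpleGraph T}
  {u : T}

/-- The isomorphism that defines `RootedGraph.plant`. -/
noncomputable def plantIso : P.plant T e G u ≃g ((⟨T, G, u⟩ : RootedGraph).attach P).G :=
  SimpleGraph.Iso.comap _ _

theorem plant_adj_of_mem {x y : V} (hx : x ∈ T) (hy : y ∈ T) :
    (P.plant T e G u).Adj x y ↔ G.Adj ⟨x, hx⟩ ⟨y, hy⟩ := by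
  classical
  rw [plant, SimpleGraph.comap_adj, Equiv.trans_apply, Equiv.trans_apply,
    Equiv.Set.sumCompl_symm_apply_of_mem hx, Equiv.Set.sumCompl_symm_apply_of_mem hy]
  exact attach_adj_inl_inl

theorem plant_induce : (P.plant T e G u).induce T = G := by
  ext x y
  exact plant_adj_of_mem x.2 y.2

theorem plant_pendantAt :
    P.PendantAt (P.plant T e G u) Tᶜ u (e.symm P.root) where
  notMem := fun h => h u.2
  mem := (e.symm P.root).2
  adj_iff := fun x hx y hy => by
    classical
    rw [Set.notMem_compl_iff] at hx
    rw [plant, SimpleGraph.comap_adj, Equiv.trans_apply, Equiv.trans_apply,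
      Equiv.Set.sumCompl_symm_apply_of_mem hx, Equiv.Set.sumCompl_symm_apply_of_notMem hy]
    refine attach_adj_inl_inr.trans (and_congr Subtype.ext_iff ?_)
    rw [← Equiv.eq_symm_apply, Subtype.ext_iff]
  exists_iso := by
    classical
    refine ⟨⟨e, ?_⟩, e.apply_symm_apply P.root⟩
    intro x y
    change _ ↔ (P.plant T e G u).Adj x y
    rw [plant, SimpleGraph.comap_adj, Equiv.trans_apply, Equiv.trans_apply,
      Equiv.Set.sumCompl_symm_apply_of_notMem x.2, Equiv.Set.sumCompl_symm_apply_of_notMem y.2]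
    exact attach_adj_inr_inr.symm

end RootedGraph

namespace GraphClass

/-- The connected members of a class without a pendant copy of `P`. -/
def withoutPendant (C : GraphClass) (P : RootedGraph) : GraphClass where
  Mem G := C.Mem G ∧ G.Connected ∧ ¬ P.IsPendantIn G
  iso_closed G H e h := ⟨C.iso_closed G H e h.1, (SimpleGraph.Iso.connected_iff e.some).1 h.2.1,
    fun h' => h.2.2 (h'.iso e.some.symm)⟩

/-- Attaching `P` to any vertex of a connected member without a pendant copy of `P` creates a graph
with only one such copy that can be removed again, so nothing is counted twice. -/
theorem Addable.count_withoutPendant_le {C : GraphClass} (hC : C.Addable) {P : RootedGraph}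
    (hP : P.IsConnectedMember C) {n : ℕ} (hn : Nat.card P.V < n) :
    (n + Nat.card P.V).choose n * ((C.withoutPendant P).count n * n) ≤
      C.count (n + Nat.card P.V) := by
  classical
  set h := Nat.card P.V with hh
  have hT : ∀ T : Finset.powersetCard n (Finset.univ : Finset (Fin (n + h))), T.1.card = n :=
    fun T => (Finset.mem_powersetCard.1 T.2).2
  have hTc : ∀ T : Finset.powersetCard n (Finset.univ : Finset (Fin (n + h))),
      ((T.1 : Set (Fin (n + h)))ᶜ).ncard = h := by
    intro T
    rw [Set.ncard_compl, Set.ncard_coe_finset, hT, Nat.card_fin, Nat.add_sub_cancel_left]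
  have he : ∀ T : Finset.powersetCard n (Finset.univ : Finset (Fin (n + h))),
      Nonempty (((T.1 : Set (Fin (n + h)))ᶜ : Set (Fin (n + h))) ≃ P.V) := fun T =>
    Finite.card_eq.1 ((Nat.card_coe_set_eq _).trans (hTc T))
  let e := fun T => (he T).some
  have h1 : Nat.card (Σ T : Finset.powersetCard n (Finset.univ : Finset (Fin (n + h))),
      {G : SimpleGraph (T.1 : Set (Fin (n + h))) // (C.withoutPendant P).Mem G} ×
        (T.1 : Set (Fin (n + h)))) ≤ Nat.card {G : SimpleGraph (Fin (n + h)) // C.Mem G} := by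
    refine Nat.card_le_card_of_injective
      (fun x => ⟨P.plant x.1.1 (e x.1) x.2.1.1 x.2.2, ?_⟩) ?_
    · refine (C.mem_iso RootedGraph.plantIso).2 (RootedGraph.mem_attach hC ?_ hP.1)
      exact x.2.1.2.1
    · rintro ⟨T, ⟨G, hG⟩, u⟩ ⟨T', ⟨G', hG'⟩, u'⟩ hx
      have hX : P.plant (T.1 : Set (Fin (n + h))) (e T) G u = P.plant (T'.1 : Set (Fin (n + h))) (e T') G' u' := congrArg Subtype.val hx
      have hp := RootedGraph.plant_pendantAt (e := e T) (G := G) (u := u)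
      have hp' := RootedGraph.plant_pendantAt (e := e T') (G := G') (u := u')
      have hi := RootedGraph.plant_induce (e := e T) (G := G) (u := u)
      have hi' := RootedGraph.plant_induce (e := e T') (G := G') (u := u')
      have hconn : (P.plant (T.1 : Set (Fin (n + h))) (e T) G u).Connected :=
        (SimpleGraph.Iso.connected_iff RootedGraph.plantIso).2
          (RootedGraph.attach_connected hG.2.1 hP.2)
      rw [← hX] at hp' hi'
      have hTT' : T = T' := by
        have := RootedGraph.PendantAt.unique hP.2 hconn (by rw [hTc, Nat.card_fin]; omega)
          ((hTc T).trans (hTc T').symm) hp hp' ?_ ?_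
        · exact Subtype.ext (Finset.coe_injective (compl_injective this))
        · rw [compl_compl, hi]
          exact hG.2.2
        · rw [compl_compl, hi']
          exact hG'.2.2
      subst hTT'
      have hu : u = u' := by
        have := (hp.adj_iff u hp.notMem _ hp.mem).2 ⟨rfl, rfl⟩
        exact Subtype.ext ((hp'.adj_iff u hp.notMem _ hp.mem).1 this).1
      have hGG' : G = G' := hi.symm.trans hi'
      subst hu hGG'
      rfl
  rw [C.card_mem, Nat.card_fin, Nat.card_sigma] at h1
  refine le_trans (le_of_eq ?_) h1
  rw [Finset.sum_congr rfl fun T _ => (show _ = (C.withoutPendant P).count n * n from ?_),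
    Finset.sum_const, Finset.card_univ, Fintype.card_coe, Finset.card_powersetCard,
    Finset.card_univ, Fintype.card_fin, smul_eq_mul]
  rw [Nat.card_prod, card_mem, Nat.card_coe_set_eq, Set.ncard_coe_finset, hT T]

end GraphClass

/-! ### Limit laws -/

namespace GraphClass

/-- The coefficients of the exponential generating function of a class. -/
noncomputable def egf (C : GraphClass) (n : ℕ) : ℝ := C.count n / n.factorial

theorem egf_nonneg (C : GraphClass) (n : ℕ) : 0 ≤ C.egf n := by
  unfold egf
  positivity

theorem count_mono {A B : GraphClass} {n : ℕ}
    (h : ∀ G : SimpleGraph (Fin n), A.Mem G → B.Mem G) : A.count n ≤ B.count n :=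
  Set.ncard_le_ncard h (Set.toFinite _)

theorem egf_mono {A B : GraphClass} {n : ℕ}
    (h : ∀ G : SimpleGraph (Fin n), A.Mem G → B.Mem G) : A.egf n ≤ B.egf n :=
  div_le_div_of_nonneg_right (by exact_mod_cast count_mono h) (by positivity)

theorem ofType_egf_le {C : GraphClass} {q n : ℕ} {t : MSOType q Empty} :
    (C.ofType q t).egf n ≤ C.egf n :=
  egf_mono fun _ (h : _ ∧ _) => h.1

theorem ofType_connected {C : GraphClass} {q : ℕ} {t : MSOType q Empty} {V : Type} [Finite V]
    (G : SimpleGraph V) (h : (C.connectedPart.ofType q t).Mem G) : G.Connected := h.1.2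

theorem sum_div_factorial (A B : GraphClass) {n : ℕ} {s : Finset (ℕ × ℕ)}
    (hs : s ⊆ antidiagonal n) :
    ((∑ p ∈ s, n.choose p.1 * (p.1 * (A.count p.1 * B.count p.2)) : ℕ) : ℝ) / n.factorial =
      ∑ p ∈ s, p.1 * A.egf p.1 * B.egf p.2 := by
  rw [Nat.cast_sum, Finset.sum_div]
  refine Finset.sum_congr rfl fun p hp => ?_
  have hp' := mem_antidiagonal.1 (hs hp)
  subst hp'
  have h := Nat.add_choose_mul_factorial_mul_factorial p.1 p.2
  have h' : ((p.1 + p.2).factorial : ℝ) =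
      (p.1 + p.2).choose p.1 * p.1.factorial * p.2.factorial := by
    rw [← h, Nat.choose_symm_add]
    push_cast
    ring
  have h1 : (p.1.factorial : ℝ) ≠ 0 := by positivity
  have h2 : (p.2.factorial : ℝ) ≠ 0 := by positivity
  have h3 : ((p.1 + p.2).choose p.1 : ℝ) ≠ 0 := by
    exact_mod_cast (Nat.choose_pos (Nat.le_add_right _ _)).ne'
  rw [h', egf, egf]
  push_cast
  field_simp

theorem Decomposable.count_zero {C : GraphClass} (hC : C.Decomposable) : C.count 0 = 1 := by
  have h : C.onFin 0 = {⊥} := by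
    ext G
    simp only [onFin, Set.mem_ofPred_eq, Set.mem_singleton_iff]
    exact iff_of_true (hC.mem_of_isEmpty G) (Subsingleton.elim _ _)
  rw [count, h, Set.ncard_singleton]

theorem Smooth.smoothPair {C : GraphClass} (hs : C.Smooth) (hC : C.Addable) :
    ∃ γ, SmoothPair C.egf C.connectedPart.egf γ := by
  obtain ⟨hne, γ, hγ⟩ := hs
  refine ⟨γ, C.egf_nonneg, C.connectedPart.egf_nonneg, ?_, ?_, ?_, ?_, ?_, ?_⟩
  · simp [egf, hC.1.count_zero]
  · intro n
    rw [← sum_div_factorial _ _ (Finset.Subset.refl _), ← hC.1.count_mul, egf]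
    push_cast
    ring
  · intro K n
    rw [← sum_div_factorial _ _ (Finset.filter_subset _ _), egf, ← mul_div_assoc, ← mul_div_assoc]
    refine div_le_div_of_nonneg_right ?_ (by positivity)
    have := hC.tail_le K n
    calc _ ≤ ((C.count n * (2 * n) : ℕ) : ℝ) := by exact_mod_cast this
      _ = _ := by push_cast; ring
  · filter_upwards [hne] with n hn
    have : (n.factorial : ℝ) ≠ 0 := by positivity
    exact div_ne_zero (by exact_mod_cast hn) this
  · refine hγ.congr fun n => ?_
    have : (n.factorial : ℝ) ≠ 0 := by positivity
    rw [egf, egf, Nat.factorial_succ]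
    push_cast
    field_simp
  · obtain ⟨n, hn, hn0⟩ := (hne.and (eventually_gt_atTop 0)).exists
    have h1 : n * C.count n ≠ 0 := mul_ne_zero hn0.ne' hn
    rw [hC.1.count_mul] at h1
    obtain ⟨p, -, hp⟩ := Finset.exists_ne_zero_of_sum_ne_zero h1
    have h2 : p.1 ≠ 0 := fun h => hp (by simp [h])
    have h3 : C.connectedPart.count p.1 ≠ 0 := fun h => hp (by simp [h])
    refine ⟨p.1, Nat.pos_of_ne_zero h2, ?_⟩
    have : 0 < C.connectedPart.count p.1 := Nat.pos_of_ne_zero h3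
    unfold egf
    positivity

theorem exists_connectedMember {C : GraphClass} {h : ℕ} (hh : 0 < C.connectedPart.egf h) :
    ∃ A : RootedGraph, A.IsConnectedMember C := by
  have h1 : C.connectedPart.count h ≠ 0 := fun h0 => by simp [egf, h0] at hh
  obtain ⟨G, hG⟩ := Set.nonempty_of_ncard_ne_zero h1
  have hG' : C.connectedPart.Mem G := hG
  exact ⟨⟨Fin h, G, hG'.2.nonempty.some⟩, hG'⟩

theorem withoutPendant_tendsto {C : GraphClass} (hC : C.Addable) {γ : ℝ}
    (H : SmoothPair C.egf C.connectedPart.egf γ) {P : RootedGraph} (hP : P.IsConnectedMember C) :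
    Tendsto (fun n => (C.withoutPendant P).egf n / C.egf n) atTop (𝓝 0) := by
  set h := Nat.card P.V with hh
  have hlim : Tendsto (fun n : ℕ => (h.factorial : ℝ) / n * (C.egf (n + h) / C.egf n)) atTop
      (𝓝 (0 * γ ^ h)) :=
    (tendsto_const_div_atTop_nhds_zero_nat _).mul (H.ratio_pow h)
  rw [zero_mul] at hlim
  refine squeeze_zero' (Eventually.of_forall fun n =>
    div_nonneg (egf_nonneg _ _) (egf_nonneg _ _)) ?_ hlim
  filter_upwards [H.b_pos, eventually_gt_atTop h] with n hb hn
  have hn0 : (0 : ℝ) < n := by exact_mod_cast (by omega : 0 < n)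
  rw [← mul_div_assoc]
  refine div_le_div_of_nonneg_right ?_ hb.le
  rw [div_mul_eq_mul_div, le_div_iff₀ hn0]
  have h1 := hC.count_withoutPendant_le hP hn
  have h2 : (((n + h).choose n : ℕ) : ℝ) * ((C.withoutPendant P).count n * n) ≤
      C.count (n + h) := by exact_mod_cast h1
  have h3 : ((n + h).factorial : ℝ) = (n + h).choose n * n.factorial * h.factorial := by
    rw [← Nat.add_choose_mul_factorial_mul_factorial n h, Nat.choose_symm_add]
    push_cast
    ring
  have h4 : ((n + h).choose n : ℝ) ≠ 0 := by
    exact_mod_cast (Nat.choose_pos (Nat.le_add_right _ _)).ne'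
  have h5 : (n.factorial : ℝ) ≠ 0 := by positivity
  have h6 : (h.factorial : ℝ) ≠ 0 := by positivity
  calc (C.withoutPendant P).egf n * n
      = h.factorial * ((((n + h).choose n : ℕ) : ℝ) * ((C.withoutPendant P).count n * n) /
          (n + h).factorial) := by
        rw [egf, h3]
        field_simp
    _ ≤ h.factorial * (C.count (n + h) / (n + h).factorial) := by gcongr

/-- The zero-one law for the connected members: almost all of them have the same type. -/
theorem connected_ofType_tendsto {C : GraphClass} (hC : C.Addable) {γ : ℝ}
    (H : SmoothPair C.egf C.connectedPart.egf γ) (q : ℕ) (t : MSOType q Empty) :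
    ∃ l, Tendsto (fun n => (C.connectedPart.ofType q t).egf n / C.egf n) atTop (𝓝 l) := by
  obtain ⟨h, -, hh⟩ := H.exists_c_pos
  obtain ⟨A, hA⟩ := exists_connectedMember hh
  obtain ⟨P, t₀, hP, ht₀⟩ := RootedGraph.exists_absorbing hC hA q
  have hbad := withoutPendant_tendsto hC H hP
  have hpend : ∀ {n : ℕ} (G : SimpleGraph (Fin n)), C.connectedPart.Mem G → P.IsPendantIn G →
      MSOType.ofGraph q G = t₀ := by
    rintro n G hG ⟨F, ⟨e⟩⟩
    rw [MSOType.ofGraph_iso q e]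
    exact ht₀ F ((C.mem_iso e).2 hG.1) (e.connected_iff.2 hG.2)
  by_cases ht : t = t₀
  · subst ht
    obtain ⟨p, hp⟩ := H.connected_tendsto
    refine ⟨p, tendsto_of_tendsto_of_tendsto_of_le_of_le
      (by simpa using hp.sub hbad) hp (fun n => ?_) (fun n => ?_)⟩
    · change C.connectedPart.egf n / C.egf n - (C.withoutPendant P).egf n / C.egf n ≤ _
      rw [← sub_div]
      refine div_le_div_of_nonneg_right ?_ (egf_nonneg _ _)
      rw [sub_le_iff_le_add, egf, egf, egf, ← add_div]
      refine div_le_div_of_nonneg_right ?_ (by positivity)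
      have h1 : C.connectedPart.onFin n ⊆
          (C.connectedPart.ofType q t).onFin n ∪ (C.withoutPendant P).onFin n := by
        intro G hG
        by_cases hG' : P.IsPendantIn G
        · exact Or.inl ⟨hG, hpend G hG hG'⟩
        · exact Or.inr ⟨hG.1, hG.2, hG'⟩
      exact_mod_cast (Set.ncard_le_ncard h1 (Set.toFinite _)).trans (Set.ncard_union_le _ _)
    · exact div_le_div_of_nonneg_right (ofType_egf_le) (egf_nonneg _ _)
  · refine ⟨0, squeeze_zero (fun n => div_nonneg (egf_nonneg _ _) (egf_nonneg _ _))
      (fun n => div_le_div_of_nonneg_right (egf_mono fun G hG => ?_) (egf_nonneg _ _)) hbad⟩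
    exact ⟨hG.1.1, hG.1.2, fun hG' => ht (hG.2.symm.trans (hpend G hG.1 hG'))⟩

/-- The types of the graphs that satisfy a sentence. -/
def satTypes (φ : MSOSentence) : Set (MSOType φ.rank Empty) :=
  {t | ∃ (V : Type) (G : SimpleGraph V), MSOType.ofGraph φ.rank G = t ∧ SatisfiesMSO G φ}

theorem mem_satTypes {φ : MSOSentence} {V : Type} {G : SimpleGraph V} :
    MSOType.ofGraph φ.rank G ∈ satTypes φ ↔ SatisfiesMSO G φ :=
  ⟨fun ⟨_, _, h, h'⟩ => (MSOType.satisfiesMSO_iff h).1 h', fun h => ⟨V, G, rfl, h⟩⟩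

theorem ofGraph_comp (q : ℕ) {V : Type} (G : SimpleGraph V) (v : V) : MSOType.ofGraph q G =
    MSOType.ofGraph q (G.induce (comp G v)) + MSOType.ofGraph q (G.induce (comp G v)ᶜ) := by
  rw [← MSOType.ofGraph_sum]
  exact MSOType.ofGraph_iso q (G.sumIsoOfNoCross _ (comp_noCross G v))

/-- Members that satisfy a sentence, counted by the types of the component of a vertex and of the
rest. -/
theorem Decomposable.mul_card_sat {C : GraphClass} (hC : C.Decomposable) (φ : MSOSentence) (n : ℕ)
    [Fintype {t : MSOType φ.rank Empty × MSOType φ.rank Empty // t.1 + t.2 ∈ satTypes φ}] :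
    n * {G ∈ C.onFin n | SatisfiesMSO G φ}.ncard =
      ∑ t : {t : MSOType φ.rank Empty × MSOType φ.rank Empty // t.1 + t.2 ∈ satTypes φ},
        Nat.card (Pointed (C.connectedPart.ofType φ.rank t.1.1) (C.ofType φ.rank t.1.2)
          (Fin n)) := by
  have h0 : n * {G ∈ C.onFin n | SatisfiesMSO G φ}.ncard =
      Nat.card ({G ∈ C.onFin n | SatisfiesMSO G φ} × Fin n) := by
    rw [Nat.card_prod, Nat.card_fin, Nat.card_coe_set_eq, mul_comm]
  rw [← Nat.card_sigma, h0]
  have key : ∀ {G : SimpleGraph (Fin n)} {v : Fin n},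
      SatisfiesMSO G φ ↔ MSOType.ofGraph φ.rank (G.induce (comp G v)) +
        MSOType.ofGraph φ.rank (G.induce (comp G v)ᶜ) ∈ satTypes φ := by
    intro G v
    rw [← ofGraph_comp, mem_satTypes]
  exact Nat.card_congr
    { toFun := fun x => ⟨⟨(_, _), key.1 x.1.2.2⟩, ⟨(x.1.1, x.2),
        ⟨((hC.mem_iff_comp _ _).2 x.1.2.1).1, rfl⟩, ⟨((hC.mem_iff_comp _ _).2 x.1.2.1).2, rfl⟩⟩⟩
      invFun := fun x => ⟨⟨x.2.1.1, (hC.mem_iff_comp _ _).1 ⟨x.2.2.1.1, x.2.2.2.1⟩,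
        key.2 (by rw [x.2.2.1.2, x.2.2.2.2]; exact x.1.2)⟩, x.2.1.2⟩
      left_inv := fun _ => rfl
      right_inv := by
        rintro ⟨⟨⟨a, b⟩, hab⟩, ⟨⟨G, v⟩, h⟩⟩
        have ha : MSOType.ofGraph φ.rank (G.induce (comp G v)) = a := h.1.2
        have hb : MSOType.ofGraph φ.rank (G.induce (comp G v)ᶜ) = b := h.2.2
        subst ha hb
        rfl }

theorem prob_tendsto {C : GraphClass} (hs : C.Smooth) (hC : C.Addable) (φ : MSOSentence) :
    ∃ p, Tendsto (fun n => C.prob n φ) atTop (𝓝 p) := by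
  classical
  obtain ⟨γ, H⟩ := hs.smoothPair hC
  have := Fintype.ofFinite
    {t : MSOType φ.rank Empty × MSOType φ.rank Empty // t.1 + t.2 ∈ satTypes φ}
  let u : MSOType φ.rank Empty × MSOType φ.rank Empty → ℕ → ℝ := fun t n =>
    (Nat.card (Pointed (C.connectedPart.ofType φ.rank t.1) (C.ofType φ.rank t.2) (Fin n)) : ℝ) /
      n.factorial / n
  have hu : ∀ t (n : ℕ), n * u t n = ∑ p ∈ antidiagonal n,
      p.1 * (C.connectedPart.ofType φ.rank t.1).egf p.1 * (C.ofType φ.rank t.2).egf p.2 := by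
    intro t n
    rw [← sum_div_factorial _ _ (Finset.Subset.refl _), ← card_pointed ofType_connected]
    rcases Nat.eq_zero_or_pos n with rfl | hn
    · have : IsEmpty (Pointed (C.connectedPart.ofType φ.rank t.1) (C.ofType φ.rank t.2)
          (Fin 0)) := ⟨fun p => p.1.2.elim0⟩
      simp
    · have : (n : ℝ) ≠ 0 := by exact_mod_cast hn.ne'
      exact mul_div_cancel₀ _ this
  have hlim : ∀ t, ∃ l, Tendsto (fun n => u t n / C.egf n) atTop (𝓝 l) := by
    intro t
    obtain ⟨σ, hσ⟩ := connected_ofType_tendsto hC H φ.rank t.1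
    exact H.exists_tendsto (egf_nonneg _) (fun n => ofType_egf_le) (egf_nonneg _)
      (fun n => ofType_egf_le) hσ (hu t)
  choose l hl using hlim
  refine ⟨∑ t : {t : MSOType φ.rank Empty × MSOType φ.rank Empty // t.1 + t.2 ∈ satTypes φ}, l t,
    (tendsto_finsetSum _ fun t _ => hl t.1).congr' ?_⟩
  filter_upwards [eventually_gt_atTop 0] with n hn
  have hn' : (n : ℝ) ≠ 0 := by exact_mod_cast hn.ne'
  have hf : (n.factorial : ℝ) ≠ 0 := by positivity
  rw [← Finset.sum_div, prob, egf]
  simp only [u]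
  rw [← Finset.sum_div, ← Finset.sum_div, ← Nat.cast_sum, ← hC.1.mul_card_sat φ n]
  push_cast
  field_simp

/-! ### Connectedness -/

/-- The sentence saying that a graph is connected: there is a vertex, and every set of vertices that
is neither empty nor everything has an edge to its complement. -/
def connSentence : MSOSentence :=
  .and (.ex (.eq 0 0)) (.allSet (.or
    (.not (.and (.ex (.mem 0 0)) (.ex (.not (.mem 0 0)))))
    (.ex (.ex (.and (.and (.mem 0 0) (.not (.mem 1 0))) (.adj 0 1))))))

theorem satisfiesMSO_connSentence {V : Type} (G : SimpleGraph V) :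
    SatisfiesMSO G connSentence ↔ G.Connected := by
  have h0 : SatisfiesMSO G connSentence ↔ (∃ _ : V, True) ∧ ∀ A : Set V,
      (¬ ((∃ x, x ∈ A) ∧ ∃ y, y ∉ A)) ∨ ∃ x y, (x ∈ A ∧ y ∉ A) ∧ G.Adj x y := by
    simp [SatisfiesMSO, connSentence, MSOFormula.Realize, Fin.snoc]
  rw [h0]
  constructor
  · rintro ⟨⟨v, -⟩, h⟩
    have : Nonempty V := ⟨v⟩
    refine ⟨fun x y => ?_⟩
    by_contra hxy
    rcases h {z | G.Reachable x z} with h | ⟨a, b, ⟨ha, hb⟩, hab⟩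
    · exact h ⟨⟨x, SimpleGraph.Reachable.refl x⟩, ⟨y, hxy⟩⟩
    · exact hb (SimpleGraph.Reachable.trans ha hab.reachable)
  · intro h
    refine ⟨⟨h.nonempty.some, trivial⟩, fun A => ?_⟩
    by_contra! hA
    obtain ⟨⟨⟨x, hx⟩, ⟨y, hy⟩⟩, hA⟩ := hA
    exact hy (SimpleGraph.Reachable.mem_of_noCross (fun a ha b hb => hA a b ⟨ha, hb⟩) hx
      (h.preconnected x y))

theorem prob_connSentence (C : GraphClass) (n : ℕ) :
    C.prob n connSentence = C.connectedPart.egf n / C.egf n := by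
  have h : {G ∈ C.onFin n | SatisfiesMSO G connSentence} = C.connectedPart.onFin n := by
    ext G
    exact and_congr_right fun _ => satisfiesMSO_connSentence G
  have hf : (n.factorial : ℝ) ≠ 0 := by positivity
  rw [prob, h, egf, egf, div_div_div_cancel_right₀ hf]
  rfl

end GraphClass

theorem mainTheorem3 (C : GraphClass) (hsmooth : C.Smooth) (haddable : C.Addable) :
    (∀ φ : MSOSentence, ∃ p : ℝ, Tendsto (fun n : ℕ => C.prob n φ) atTop (𝓝 p)) ∧
      (∃ (φ : MSOSentence) (p : ℝ), 0 < p ∧ p < 1 ∧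
        Tendsto (fun n : ℕ => C.prob n φ) atTop (𝓝 p)) := by
  refine ⟨GraphClass.prob_tendsto hsmooth haddable, ?_⟩
  obtain ⟨γ, H⟩ := hsmooth.smoothPair haddable
  obtain ⟨p, hp⟩ := H.connected_tendsto
  obtain ⟨h0, h1⟩ := H.limit_mem_Ioo hp
  exact ⟨GraphClass.connSentence, p, h0, h1,
    hp.congr fun n => (C.prob_connSentence n).symm⟩
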